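/- Setting. Let $d\ge 1$, $\alpha>1/2$, and let $\gamma=(\gamma_u)_u$ be weights with $0<\gamma_u\le 1$, indexed by the finite sets $u\subseteq\{1,\dots,d\}$. For $k\in\mathbb{Z}^d$ put $\mathrm{supp}(k)=\{j:k_j\neq 0\}$ and $r_{d,\alpha,\gamma}(k)=\gamma_{\mathrm{supp}(k)}^{-1}\prod_{j\in\mathrm{supp}(k)}|k_j|^\alpha$. The weighted Korobov space $\mathcal{H}_{d,\alpha,\gamma}$ consists of all $f\colon[0,1]^d\to\mathbb{C}$ with an absolutely convergent Fourier series $f(x)=\sum_{k\in\mathbb{Z}^d}\hat f(k)e^{2\pi i k\cdot x}$ and finite norm $\|f\|_{d,\alpha,\gamma}=\big(\sum_{k\in\mathbb{Z}^d} r_{d,\alpha,\gamma}(k)^2|\hat f(k)|^2\big)^{1/2}$. Let $I_d(f)=\int_{[0,1]^d}f(x)\,dx$, and for a prime $p$ and $z\in\{1,\dots,p-1\}^d$ let $Q_p^z(f)=\frac1p\sum_{k=0}^{p-1}f(\{kz/p\})$, where $\{\cdot\}$ is the entry-wise fractional part. For $s>1$ and weights $w=(w_u)_u$ put $V_d(s,w)=\sum_{\emptyset\ne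 u\subseteq\{1,\dots,d\}}w_u\,(2\zeta(s))^{|u|}$, and write $\gamma^{1/\lambda}=(\gamma_u^{1/\lambda})_u$. The median algorithm. Let $h\colon\mathbb{N}\to[1,\infty)$ with $h(n)\to\infty$ as $n\to\infty$. For $n\ge 2$ let $\mathcal{P}_n$ be the (nonempty) set of primes $p$ with $\lceil n/2\rceil+1\le p\le n$, and let $N=2\lceil h(n)\log_2 n\rceil+1$. Independently for $k=1,\dots,N$, choose $p_k$ uniformly from $\mathcal{P}_n$ and then $z_k$ uniformly from $\{1,\dots,p_k-1\}^d$, and let $M_n(f)$ be the median of $Q_{p_1}^{z_1}(f),\dots,Q_{p_N}^{z_N}(f)$, where the median of complex numbers is taken separately in the real and imaginary parts. Theorem. For every $\lambda>1/2$ and every $\delta\in(0,\min\{\lambda-1/2,1\})$ there is a constant $C_{\lambda,\delta}>0$, depending only on $\lambda$ and $\delta$, such that for all $h$ as above, all $d\ge1$, all $\alpha>\lambda$, all weights $\gamma=(\gamma_u)_u$ with $0<\gamma_u\le1$, all $f\in\mathcal{H}_{d,\alpha,\gamma}$, and all integers $n\ge2$ with $n\ge 64\,V_d(\alpha/\lambda,\gamma^{1/\lambda})$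 and $h(n)\ge\lambda+1/2$, $$\mathbb{E}\,|I_d(f)-M_n(f)|\le C_{\lambda,\delta}\,V_d(\alpha/\lambda,\gamma^{1/\lambda})^{\lambda}\,n^{-\lambda-1/2+\delta}\,\|f\|_{d,\alpha,\gamma}.$$ -/

import Mathlib

open scoped BigOperators

noncomputable section

namespace MedianLattice

/-! ### Lattice rules and the median algorithm -/

/-- The primes `p` with `⌈n / 2⌉ + 1 ≤ p ≤ n`. Here `(n + 1) / 2` is `⌈n / 2⌉`. -/
def primeRange (n : ℕ) : Finset ℕ :=
  (Finset.Icc ((n + 1) / 2 + 1) n).filter Nat.Prime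

/-- The full set `{1, …, p - 1} ^ d` of generating vectors. -/
def genVectors (d p : ℕ) : Finset (Fin d → ℕ) :=
  Fintype.piFinset fun _ => Finset.Icc 1 (p - 1)

/-- The lattice rule `Q_p^z (f) = (1 / p) ∑_{k < p} f ({k z / p})`. -/
def latticeRule {d : ℕ} (p : ℕ) (z : Fin d → ℕ) (f : (Fin d → ℝ) → ℂ) : ℂ :=
  (1 / (p : ℂ)) * ∑ k ∈ Finset.range p, f fun j => Int.fract ((k : ℝ) * (z j : ℝ) / (p : ℝ))

/-- The median of an odd number `2 K + 1` of reals: the middle entry after sorting. -/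
def median {K : ℕ} (a : Fin (2 * K + 1) → ℝ) : ℝ :=
  a (Tuple.sort a ⟨K, by omega⟩)

/-- The median of complex numbers, taken separately in the real and the imaginary parts. -/
def complexMedian {K : ℕ} (a : Fin (2 * K + 1) → ℂ) : ℂ :=
  ⟨median fun k => (a k).re, median fun k => (a k).im⟩

/-- `⌈h(n) log₂ n⌉`; the algorithm uses `2 * halfReps h n + 1` repetitions. -/
def halfReps (h : ℕ → ℝ) (n : ℕ) : ℕ :=
  ⌈h n * Real.logb 2 n⌉₊

/-- One random draw: a pair `⟨p, z⟩` of a number of points and a generating vector. -/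
abbrev Draw (d : ℕ) : Type := (_ : ℕ) × (Fin d → ℕ)

/-- The possible draws: `p` a prime in `primeRange n`, and `z` in `{1, …, p - 1} ^ d`. -/
def draws (n d : ℕ) : Finset (Draw d) :=
  (primeRange n).sigma fun p => genVectors d p

/-- The probability of a draw: `p` is uniform on `primeRange n` and, given `p`, the vector `z` is
uniform on `{1, …, p - 1} ^ d`. -/
def drawProb (n d : ℕ) (ω : Draw d) : ℝ :=
  1 / ((primeRange n).card : ℝ) * (1 / ((genVectors d ω.1).card : ℝ))

/-- The expectation of `X` over `N` independent draws. -/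
def expectation (n d N : ℕ) (X : (Fin N → Draw d) → ℝ) : ℝ :=
  ∑ ω ∈ Fintype.piFinset fun _ : Fin N => draws n d, (∏ k, drawProb n d (ω k)) * X ω

/-- The output of the median algorithm for a realization `ω = (p_k, z_k)_k` of the draws. -/
def medianRule {d K : ℕ} (ω : Fin (2 * K + 1) → Draw d) (f : (Fin d → ℝ) → ℂ) : ℂ :=
  complexMedian fun k => latticeRule (ω k).1 (ω k).2 f

/-! ### The weighted Korobov space -/

/-- The integral of `f` over `[0,1] ^ d`. -/
def cubeIntegral {d : ℕ} (f : (Fin d → ℝ) → ℂ) : ℂ :=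
  ∫ x in Set.Icc (0 : Fin d → ℝ) 1, f x

/-- The exponential `x ↦ exp (2 π i k · x)`. -/
def expChar {d : ℕ} (k : Fin d → ℤ) (x : Fin d → ℝ) : ℂ :=
  Complex.exp (2 * Real.pi * Complex.I * ((∑ j, (k j : ℝ) * x j : ℝ) : ℂ))

/-- The `k`-th Fourier coefficient of `f` on `[0,1] ^ d`. -/
def fourierCoeffCube {d : ℕ} (f : (Fin d → ℝ) → ℂ) (k : Fin d → ℤ) : ℂ :=
  cubeIntegral fun x => f x * expChar (-k) x

/-- `supp k = {j : k_j ≠ 0}`. -/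
def freqSupp {d : ℕ} (k : Fin d → ℤ) : Finset (Fin d) :=
  Finset.univ.filter fun j => k j ≠ 0

/-- `r(k) = γ_{supp k}⁻¹ ∏_{j ∈ supp k} |k_j| ^ α`. -/
def korobovR {d : ℕ} (α : ℝ) (γ : Finset (Fin d) → ℝ) (k : Fin d → ℤ) : ℝ :=
  (γ (freqSupp k))⁻¹ * ∏ j ∈ freqSupp k, |(k j : ℝ)| ^ α

/-- Membership in the weighted Korobov space: on `[0,1] ^ d` the function is the sum of its
absolutely convergent Fourier series, and its Korobov norm is finite. Only the values of `f` on
`[0,1] ^ d` matter. -/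
structure MemKorobov {d : ℕ} (α : ℝ) (γ : Finset (Fin d) → ℝ) (f : (Fin d → ℝ) → ℂ) : Prop where
  summable_coeff : Summable fun k : Fin d → ℤ => ‖fourierCoeffCube f k‖
  hasSum_fourier : ∀ x ∈ Set.Icc (0 : Fin d → ℝ) 1,
    HasSum (fun k : Fin d → ℤ => fourierCoeffCube f k * expChar k x) (f x)
  summable_norm : Summable fun k : Fin d → ℤ => korobovR α γ k ^ 2 * ‖fourierCoeffCube f k‖ ^ 2

/-- The Korobov norm `(∑_k r(k)² |f̂(k)|²) ^ (1/2)`. -/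
def korobovNorm {d : ℕ} (α : ℝ) (γ : Finset (Fin d) → ℝ) (f : (Fin d → ℝ) → ℂ) : ℝ :=
  Real.sqrt (∑' k : Fin d → ℤ, korobovR α γ k ^ 2 * ‖fourierCoeffCube f k‖ ^ 2)

/-- `V_d(α, γ) = ∑_{∅ ≠ u ⊆ {1, …, d}} γ_u (2 ζ(α)) ^ |u|`, for real `α > 1`. -/
def weightSum (d : ℕ) (α : ℝ) (γ : Finset (Fin d) → ℝ) : ℝ :=
  ∑ u ∈ (Finset.univ : Finset (Finset (Fin d))).filter Finset.Nonempty,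
    γ u * (2 * (riemannZeta (α : ℂ)).re) ^ u.card

end MedianLattice

end

open MedianLattice

open scoped BigOperators

noncomputable section

namespace MedianLattice

/-! A median of `2K+1` estimates is accurate once at most `K` of them are bad. If one draw is bad
with probability at most `1/8`, a Chernoff bound makes a bad majority as rare as `2^(-K)`, which is
at most `n^(-λ-1/2)`. On that event the worst-case error `V^λ ‖f‖` is affordable
(`expectation_le_of_bad`, `latticeRule_error_le`).

It remains to bound one good rule. Its error is the sum of `f̂(k)` over the nonzero dual lattice. A
frequency `k` is dual with probability at most `2/n + ν(k)/|P_n|`, where `ν(k)` = `numDvd n k`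
counts the primes of the range dividing all of `k`. Write `W` for `decay (α/λ) (γ^(1/λ))`, so that
`W^λ = 1/r` off zero, and put `c = max(1, ν)`. Cauchy–Schwarz gives |error|² ≤ (∑ r²|f̂|²/c) (∑ c
W^(2λ)), both sums over the nonzero dual lattice.

Dividing by `c` cancels `ν` in the probability, so the first factor has mean at most `(2/n +
1/|P_n|) ‖f‖²`, about `n^(-1+2δ) ‖f‖²` by a weak Chebyshev bound. For the second, `∑ W` over the
dual lattice has mean at most `4V/n`, hence is at most `s = 64V/n` for a good draw. Then each dual
`k ≠ 0` has `W ≤ s`. As `ν` grows at most logarithmically, `c ≤ A (s/W)^(2λ-1)` with `A` depending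
on `λ` only (`numDvd_le_rpow`), so the second factor is at most `A s^(2λ)`. The square root of the
product is the claimed rate. -/

/-! ### Robustness of the median. -/

/-- Any `K + 1` sorted positions contain a good one. Applied to the positions up to the middle and
to those from the middle on, this traps the median between two good values. -/
theorem median_mem_of_card_bad_le {K : ℕ} (a : Fin (2 * K + 1) → ℝ) (s : Finset (Fin (2 * K + 1)))
    (hs : s.card ≤ K) (c r : ℝ) (h : ∀ k ∉ s, |c - a k| ≤ r) : |c - median a| ≤ r := by
  have hmono := Tuple.monotone_sort a
  set σ := Tuple.sort a with hσ
  have key : ∀ t : Finset (Fin (2 * K + 1)), K < t.card → ∃ i ∈ t, |c - a (σ i)| ≤ r := by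
    intro t ht
    have : ¬ t.map σ.toEmbedding ⊆ s := fun hsub => by
      have := Finset.card_le_card hsub
      rw [Finset.card_map] at this
      omega
    obtain ⟨j, hj, hjs⟩ := Finset.not_subset.1 this
    obtain ⟨i, hi, rfl⟩ := Finset.mem_map.1 hj
    exact ⟨i, hi, h _ hjs⟩
  have hK : K < 2 * K + 1 := by omega
  obtain ⟨i, hi, hir⟩ := key (Finset.Iic ⟨K, hK⟩) (by simp)
  obtain ⟨j, hj, hjr⟩ := key (Finset.Ici ⟨K, hK⟩) (by simp; omega)
  have h1 : a (σ i) ≤ a (σ ⟨K, hK⟩) := hmono (Finset.mem_Iic.1 hi)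
  have h2 : a (σ ⟨K, hK⟩) ≤ a (σ j) := hmono (Finset.mem_Ici.1 hj)
  have h3 : median a = a (σ ⟨K, hK⟩) := rfl
  rw [h3]
  rw [abs_le] at *
  constructor <;> linarith

theorem complexMedian_near_of_card_bad_le {K : ℕ} (a : Fin (2 * K + 1) → ℂ)
    (s : Finset (Fin (2 * K + 1))) (hs : s.card ≤ K) (c : ℂ) (r : ℝ)
    (h : ∀ k ∉ s, ‖c - a k‖ ≤ r) : ‖c - complexMedian a‖ ≤ 2 * r := by
  have hre := median_mem_of_card_bad_le (fun k => (a k).re) s hs c.re r fun k hk => by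
    simpa using (Complex.abs_re_le_norm (c - a k)).trans (h k hk)
  have him := median_mem_of_card_bad_le (fun k => (a k).im) s hs c.im r fun k hk => by
    simpa using (Complex.abs_im_le_norm (c - a k)).trans (h k hk)
  refine (Complex.norm_le_abs_re_add_abs_im _).trans ?_
  have h1 : (c - complexMedian a).re = c.re - median fun k => (a k).re := rfl
  have h2 : (c - complexMedian a).im = c.im - median fun k => (a k).im := rfl
  rw [h1, h2]
  linarith

/-! ### Independent draws and the Chernoff bound. -/

/-- The expectation over a single draw. -/
def drawExp (n d : ℕ) (g : Draw d → ℝ) : ℝ := ∑ ω ∈ draws n d, drawProb n d ω * g ω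

theorem drawProb_nonneg (n d : ℕ) (ω : Draw d) : 0 ≤ drawProb n d ω := by
  unfold drawProb; positivity

theorem drawExp_mono {n d : ℕ} {g g' : Draw d → ℝ} (h : ∀ ω ∈ draws n d, g ω ≤ g' ω) :
    drawExp n d g ≤ drawExp n d g' :=
  Finset.sum_le_sum fun ω hω => mul_le_mul_of_nonneg_left (h ω hω) (drawProb_nonneg n d ω)

theorem drawExp_nonneg {n d : ℕ} {g : Draw d → ℝ} (h : ∀ ω ∈ draws n d, 0 ≤ g ω) :
    0 ≤ drawExp n d g :=
  Finset.sum_nonneg fun ω hω => mul_nonneg (drawProb_nonneg n d ω) (h ω hω)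

theorem drawExp_add (n d : ℕ) (g g' : Draw d → ℝ) :
    drawExp n d (fun ω => g ω + g' ω) = drawExp n d g + drawExp n d g' := by
  simp [drawExp, mul_add, Finset.sum_add_distrib]

theorem drawExp_const_mul (n d : ℕ) (c : ℝ) (g : Draw d → ℝ) :
    drawExp n d (fun ω => c * g ω) = c * drawExp n d g := by
  simp only [drawExp, Finset.mul_sum]
  exact Finset.sum_congr rfl fun _ _ => by ring

theorem drawExp_eq (n d : ℕ) (g : Draw d → ℝ) :
    drawExp n d g = 1 / ((primeRange n).card : ℝ) * ∑ p ∈ primeRange n,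
      1 / ((genVectors d p).card : ℝ) * ∑ z ∈ genVectors d p, g ⟨p, z⟩ := by
  simp only [drawExp, draws, Finset.sum_sigma, drawProb, Finset.mul_sum]
  refine Finset.sum_congr rfl fun p _ => Finset.sum_congr rfl fun z _ => by ring

theorem card_genVectors (d p : ℕ) : (genVectors d p).card = (p - 1) ^ d := by
  simp [genVectors]

theorem mem_primeRange {n p : ℕ} : p ∈ primeRange n ↔ ((n + 1) / 2 + 1 ≤ p ∧ p ≤ n) ∧ p.Prime := by
  simp [primeRange]

theorem card_genVectors_pos {n d p : ℕ} (hp : p ∈ primeRange n) : 0 < (genVectors d p).card := by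
  have := (mem_primeRange.1 hp).2.two_le
  rw [card_genVectors]
  exact pow_pos (by omega) _

theorem drawExp_one {n : ℕ} (d : ℕ) (hP : (primeRange n).Nonempty) :
    drawExp n d (fun _ => 1) = 1 := by
  have h1 : ((primeRange n).card : ℝ) ≠ 0 := by exact_mod_cast hP.card_pos.ne'
  rw [drawExp_eq, Finset.sum_congr rfl (g := fun _ => (1 : ℝ))]
  · simp [h1]
  · intro p hp
    have : ((genVectors d p).card : ℝ) ≠ 0 := by exact_mod_cast (card_genVectors_pos hp).ne'
    simp [this]

open Classical in
theorem markov_drawExp {n d : ℕ} {g : Draw d → ℝ} (h : ∀ ω ∈ draws n d, 0 ≤ g ω) (t : ℝ) :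
    t * drawExp n d (fun ω => if t < g ω then 1 else 0) ≤ drawExp n d g := by
  rw [← drawExp_const_mul]
  refine drawExp_mono fun ω hω => ?_
  split_ifs with hlt
  · linarith
  · simpa using h ω hω

theorem expectation_prod (n d N : ℕ) (g : Draw d → ℝ) :
    expectation n d N (fun ω => ∏ k, g (ω k)) = drawExp n d g ^ N := by
  unfold expectation drawExp
  simp only [← Finset.prod_mul_distrib]
  rw [← Finset.prod_univ_sum (fun _ : Fin N => draws n d) fun _ ω => drawProb n d ω * g ω]
  simp

theorem expectation_mono {n d N : ℕ} {X Y : (Fin N → Draw d) → ℝ}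
    (h : ∀ ω, (∀ k, ω k ∈ draws n d) → X ω ≤ Y ω) :
    expectation n d N X ≤ expectation n d N Y :=
  Finset.sum_le_sum fun ω hω => mul_le_mul_of_nonneg_left (h ω (Fintype.mem_piFinset.1 hω))
    (Finset.prod_nonneg fun k _ => drawProb_nonneg n d (ω k))

theorem expectation_affine {n : ℕ} (d N : ℕ) (hP : (primeRange n).Nonempty) (a b : ℝ)
    (X : (Fin N → Draw d) → ℝ) :
    expectation n d N (fun ω => a + b * X ω) = a + b * expectation n d N X := by
  have h1 : expectation n d N (fun _ => 1) = 1 := by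
    have := expectation_prod n d N fun _ => 1
    simpa [drawExp_one d hP] using this
  have h2 : expectation n d N (fun ω => a + b * X ω)
      = a * expectation n d N (fun _ => 1) + b * expectation n d N X := by
    simp only [expectation, Finset.mul_sum, ← Finset.sum_add_distrib]
    exact Finset.sum_congr rfl fun _ _ => by ring
  rw [h2, h1, mul_one]

open Classical in
/-- If a draw is bad with probability at most `1 / 8`, then more than `K` of `2 K + 1` independent
draws are bad with probability at most `2 ^ (-K)`. -/
theorem expectation_le_of_bad {n d : ℕ} (K : ℕ) (hP : (primeRange n).Nonempty)
    (B : Draw d → Prop) (hB : drawExp n d (fun ω => if B ω then 1 else 0) ≤ 1 / 8)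
    (X : (Fin (2 * K + 1) → Draw d) → ℝ) (a b : ℝ) (ha : 0 ≤ a) (hb : 0 ≤ b)
    (hXa : ∀ ω, (∀ k, ω k ∈ draws n d) → (Finset.univ.filter fun k => B (ω k)).card ≤ K → X ω ≤ a)
    (hXb : ∀ ω, (∀ k, ω k ∈ draws n d) → X ω ≤ b) :
    expectation n d (2 * K + 1) X ≤ a + b * (1 / 2) ^ K := by
  -- Exponential moment with base 7: the product of `g` over the draws is `7 ^ #bad`, and the mean
  -- of `g` is at most `1 + 6/8 = 7/4`. The resulting ratio `(7/4)² / 7 = 7/16` is below `1/2`.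
  set g : Draw d → ℝ := fun ω => if B ω then 7 else 1 with hg
  have h0 : 0 ≤ drawExp n d (fun ω => if B ω then 1 else 0) :=
    drawExp_nonneg fun ω _ => by split_ifs <;> norm_num
  have hEg : drawExp n d g = 1 + 6 * drawExp n d (fun ω => if B ω then 1 else 0) := by
    have hadd := drawExp_add n d (fun _ => 1) fun ω => 6 * if B ω then 1 else 0
    rw [drawExp_const_mul, drawExp_one d hP] at hadd
    rw [← hadd]
    refine congrArg _ (funext fun ω => ?_)
    simp only [hg]
    split_ifs <;> norm_num
  have hprod : ∀ ω : Fin (2 * K + 1) → Draw d,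
      ∏ k, g (ω k) = 7 ^ (Finset.univ.filter fun k => B (ω k)).card := fun ω => by
    simp [hg, Finset.prod_ite]
  calc expectation n d (2 * K + 1) X
      ≤ expectation n d (2 * K + 1) (fun ω => a + b / 7 ^ (K + 1) * ∏ k, g (ω k)) := by
        refine expectation_mono fun ω hω => ?_
        rw [hprod]
        by_cases hc : (Finset.univ.filter fun k => B (ω k)).card ≤ K
        · exact (hXa ω hω hc).trans (le_add_of_nonneg_right (by positivity))
        · have : (7 : ℝ) ^ (K + 1) ≤ 7 ^ (Finset.univ.filter fun k => B (ω k)).card :=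
            pow_le_pow_right₀ (by norm_num) (by omega)
          have h2 : b ≤ b / 7 ^ (K + 1) * 7 ^ (Finset.univ.filter fun k => B (ω k)).card := by
            rw [div_mul_eq_mul_div, le_div_iff₀ (by positivity)]
            exact mul_le_mul_of_nonneg_left this hb
          linarith [hXb ω hω]
    _ = a + b / 7 ^ (K + 1) * drawExp n d g ^ (2 * K + 1) := by
        rw [expectation_affine d _ hP, expectation_prod]
    _ ≤ a + b / 7 ^ (K + 1) * (7 / 4) ^ (2 * K + 1) := by
        gcongr
        · rw [hEg]; linarith
        · rw [hEg]; linarith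
    _ ≤ a + b * (1 / 2) ^ K := by
        have h3 : (7 / 4 : ℝ) ^ (2 * K + 1) / 7 ^ (K + 1) = (7 / 16) ^ K * (1 / 4) := by
          rw [pow_succ _ (2 * K), pow_mul, pow_succ _ K, mul_div_mul_comm, ← div_pow]
          norm_num
        have h4 : (7 / 16 : ℝ) ^ K ≤ (1 / 2) ^ K := pow_le_pow_left₀ (by norm_num) (by norm_num) K
        have h5 : (0 : ℝ) ≤ (7 / 16) ^ K := by positivity
        rw [div_mul_eq_mul_div, mul_div_assoc, h3]
        gcongr
        linarith

/-! ### Counting primes between `n / 2` and `n`. -/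

/-- For odd `n` the doubled ceiling is `n + 1`, one too large; but it is even, so it is not a prime
in question. -/
theorem prime_mem_primeRange {n p : ℕ} (hn : 2 ≤ n) (hp : p.Prime) (h1 : (n + 1) / 2 < p)
    (h2 : p ≤ 2 * ((n + 1) / 2)) : p ∈ primeRange n := by
  refine mem_primeRange.2 ⟨⟨h1, ?_⟩, hp⟩
  by_contra hlt
  have h3 : p = 2 * ((n + 1) / 2) := by omega
  have h4 : 2 ∣ p := ⟨_, h3⟩
  have := (Nat.prime_dvd_prime_iff_eq Nat.prime_two hp).1 h4
  omega

theorem primeRange_nonempty {n : ℕ} (hn : 2 ≤ n) : (primeRange n).Nonempty := by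
  obtain ⟨p, hp, h1, h2⟩ := Nat.exists_prime_lt_and_le_two_mul ((n + 1) / 2) (by omega)
  exact ⟨p, prime_mem_primeRange hn hp h1 h2⟩

open Nat in
-- Erdős' factorization argument for Bertrand's postulate, keeping the primes in `(m, 2m]`. Every
-- prime power in the binomial is at most `2m`, primes in `(2m/3, m]` do not occur, and those above
-- `√(2m)` occur at most once, so the ones up to `2m/3` are controlled by the primorial.
theorem centralBinom_le_pow_card_primes (m : ℕ) (hm : 2 < m) :
    centralBinom m ≤ (2 * m) ^ ((Finset.Ioc m (2 * m)).filter Nat.Prime).card *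
      ((2 * m) ^ sqrt (2 * m) * 4 ^ (2 * m / 3)) := by
  have n2_pos : 1 ≤ 2 * m := by omega
  let f x := x ^ m.centralBinom.factorization x
  have hf1 : ∀ x, ¬ x.Prime → f x = 1 := fun x hx => by
    simp only [f, factorization_eq_zero_of_not_prime m.centralBinom hx, Nat.pow_zero]
  have hf2 : ∀ x, f x ≤ 2 * m := fun x => pow_factorization_choose_le (by omega)
  let S := {p ∈ Finset.range (2 * m / 3 + 1) | Nat.Prime p}
  let S' := (Finset.Ioc m (2 * m)).filter Nat.Prime
  have hdisj : Disjoint S' S := by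
    rw [Finset.disjoint_left]
    intro x hx hx'
    simp only [S, S', Finset.mem_filter, Finset.mem_Ioc, Finset.mem_range] at hx hx'
    omega
  have hprod : m.centralBinom = (∏ p ∈ S', f p) * ∏ p ∈ S, f p := by
    rw [← Finset.prod_union hdisj, ← m.prod_pow_factorization_centralBinom]
    refine (Finset.prod_subset ?_ ?_).symm
    · intro x hx
      simp only [S, S', Finset.mem_union, Finset.mem_filter, Finset.mem_Ioc, Finset.mem_range]
        at hx ⊢
      omega
    · intro x hx hx'
      by_cases hxp : x.Prime
      · simp only [S, S', Finset.mem_union, Finset.mem_filter, Finset.mem_Ioc, Finset.mem_range]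
          at hx hx'
        have h1 : x ≤ m := by
          by_contra hlt
          exact hx' (Or.inl ⟨⟨by omega, by omega⟩, hxp⟩)
        have h2 : 2 * m / 3 < x := by
          by_contra hlt
          exact hx' (Or.inr ⟨by omega, hxp⟩)
        rw [factorization_centralBinom_of_two_mul_self_lt_three_mul hm h1 (by omega), Nat.pow_zero]
      · exact hf1 x hxp
  rw [hprod]
  refine mul_le_mul' ((Finset.prod_le_prod' fun p _ => hf2 p).trans (by simp [S'])) ?_
  rw [← Finset.prod_filter_mul_prod_filter_not S (· ≤ sqrt (2 * m))]
  apply mul_le_mul'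
  · refine (Finset.prod_le_prod' fun p _ => hf2 p).trans ?_
    have : (Finset.Icc 1 (sqrt (2 * m))).card = sqrt (2 * m) := by rw [card_Icc, Nat.add_sub_cancel]
    rw [Finset.prod_const]
    refine pow_right_mono₀ n2_pos ((Finset.card_le_card fun x hx => ?_).trans this.le)
    obtain ⟨h1, h2⟩ := Finset.mem_filter.1 hx
    exact Finset.mem_Icc.mpr ⟨(Finset.mem_filter.1 h1).2.one_lt.le, h2⟩
  · refine le_trans ?_ (primorial_le_four_pow (2 * m / 3))
    refine (Finset.prod_le_prod' fun p hp => (?_ : f p ≤ p)).trans ?_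
    · obtain ⟨h1, h2⟩ := Finset.mem_filter.1 hp
      refine (pow_right_mono₀ (Finset.mem_filter.1 h1).2.one_lt.le ?_).trans (pow_one p).le
      exact Nat.factorization_choose_le_one (sqrt_lt'.mp <| not_le.1 h2)
    refine Finset.prod_le_prod_of_subset_of_one_le' (Finset.filter_subset _ _) ?_
    exact fun p hp _ => (Finset.mem_filter.1 hp).2.one_lt.le

/-- Logarithms of `4^m < m * centralBinom m` and the preceding bound. The factor `m` is absorbed as
one more power of `2m`, hence the `+ 1`; the left side is the remaining `(m/3) log 4`, with `log 4 ≥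
1`. -/
theorem card_primes_mul_log_ge (m : ℕ) (hm : 4 ≤ m) :
    (2 * m : ℝ) / 6 ≤ (((Finset.Ioc m (2 * m)).filter Nat.Prime).card + 1 + √(2 * m : ℝ)) *
      Real.log (2 * m) := by
  set c := ((Finset.Ioc m (2 * m)).filter Nat.Prime).card
  have h1 : 4 ^ m ≤ m * ((2 * m) ^ c * ((2 * m) ^ Nat.sqrt (2 * m) * 4 ^ (2 * m / 3))) :=
    (Nat.four_pow_lt_mul_centralBinom m hm).le.trans
      (Nat.mul_le_mul_left _ (centralBinom_le_pow_card_primes m (by omega)))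
  have h2 : 4 ^ m ≤ (2 * m) ^ (c + 1 + Nat.sqrt (2 * m)) * 4 ^ (2 * m / 3) := by
    refine h1.trans ?_
    calc _ ≤ (2 * m) * ((2 * m) ^ c * ((2 * m) ^ Nat.sqrt (2 * m) * 4 ^ (2 * m / 3))) :=
          Nat.mul_le_mul_right _ (by omega)
      _ = _ := by ring
  have h3 : ((4 : ℝ) ^ m) ≤ (2 * m : ℝ) ^ (c + 1 + Nat.sqrt (2 * m)) * 4 ^ (2 * m / 3) := by
    exact_mod_cast h2
  have hm0 : (4 : ℝ) ≤ m := by exact_mod_cast hm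
  have h4 := Real.log_le_log (by positivity) h3
  rw [Real.log_mul (by positivity) (by positivity), Real.log_pow, Real.log_pow, Real.log_pow] at h4
  have h5 : ((2 * m / 3 : ℕ) : ℝ) ≤ 2 * m / 3 := by
    refine Nat.cast_div_le.trans ?_
    push_cast; rfl
  have h6 : (Nat.sqrt (2 * m) : ℝ) ≤ √(2 * m : ℝ) := by
    have := Real.nat_sqrt_le_real_sqrt (a := 2 * m)
    push_cast at this; exact this
  have h7 : (1 : ℝ) ≤ Real.log 4 := by
    rw [Real.le_log_iff_exp_le (by norm_num)]
    linarith [Real.exp_one_lt_d9]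
  have h8 : 0 ≤ Real.log (2 * m) := Real.log_nonneg (by linarith)
  push_cast at h4
  have h9 : ((c : ℝ) + 1 + Nat.sqrt (2 * m)) * Real.log (2 * m) ≤
      (c + 1 + √(2 * m : ℝ)) * Real.log (2 * m) := by gcongr
  nlinarith

/-- A weak form of Chebyshev's bound for the primes between `n / 2` and `n`. -/
theorem exists_rpow_le_card_primeRange {θ : ℝ} (hθ : θ < 1) :
    ∃ C : ℝ, 1 ≤ C ∧ ∀ n : ℕ, 2 ≤ n → (n : ℝ) ^ θ ≤ C * (primeRange n).card := by
  -- Raising the exponent to at least `1/2` lets `X ^ τ` dominate `√X` as well; `ε` is half the gap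
  -- to 1, so after `log X ≤ X ^ ε / ε` a factor `X ^ ε` is still to spare.
  set τ := max θ (1 / 2) with hτ
  have hτ1 : τ < 1 := max_lt hθ (by norm_num)
  set ε := (1 - τ) / 2 with hε
  have hε0 : 0 < ε := by rw [hε]; linarith
  refine ⟨max 8 ((18 / ε) ^ (1 / ε)), le_trans (by norm_num) (le_max_left _ _), fun n hn => ?_⟩
  have hcard : (1 : ℝ) ≤ (primeRange n).card := by
    exact_mod_cast (primeRange_nonempty hn).card_pos
  have hn1 : (1 : ℝ) ≤ n := by exact_mod_cast (by omega : 1 ≤ n)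
  have hC1 : (1 : ℝ) ≤ max 8 ((18 / ε) ^ (1 / ε)) := le_trans (by norm_num) (le_max_left _ _)
  rcases le_or_gt ((n : ℝ) ^ θ) (primeRange n).card with hle | hlt
  · exact hle.trans (le_mul_of_one_le_left (by positivity) hC1)
  -- If there are fewer than `n ^ θ` primes, then `n` itself is bounded; the constant absorbs it
  -- because there is at least one prime.
  suffices hsmall : (n : ℝ) ≤ max 8 ((18 / ε) ^ (1 / ε)) by
    calc (n : ℝ) ^ θ ≤ (n : ℝ) ^ (1 : ℝ) := Real.rpow_le_rpow_of_exponent_le hn1 hθ.le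
      _ = n := Real.rpow_one _
      _ ≤ max 8 ((18 / ε) ^ (1 / ε)) := hsmall
      _ ≤ _ := le_mul_of_one_le_right (by positivity) hcard
  rcases le_or_gt n 8 with h8 | h8
  · exact le_trans (by exact_mod_cast h8) (le_max_left _ _)
  refine le_trans ?_ (le_max_right _ _)
  obtain ⟨m, hm⟩ : ∃ m, m = (n + 1) / 2 := ⟨_, rfl⟩
  have hm4 : 4 ≤ m := by omega
  have hsub : ((Finset.Ioc m (2 * m)).filter Nat.Prime) ⊆ primeRange n := fun p hp => by
    simp only [Finset.mem_filter, Finset.mem_Ioc] at hp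
    exact prime_mem_primeRange hn hp.2 (by omega) (by omega)
  have hcc : ((((Finset.Ioc m (2 * m)).filter Nat.Prime).card : ℕ) : ℝ) ≤ (primeRange n).card := by
    exact_mod_cast Finset.card_le_card hsub
  set X : ℝ := 2 * m with hX
  have hnX : (n : ℝ) ≤ X := by rw [hX]; exact_mod_cast (by omega : n ≤ 2 * m)
  have hX1 : 1 ≤ X := hn1.trans hnX
  have hmain := card_primes_mul_log_ge m hm4
  rw [← hX] at hmain
  have hb1 : (n : ℝ) ^ θ ≤ X ^ τ :=
    calc (n : ℝ) ^ θ ≤ (n : ℝ) ^ τ := Real.rpow_le_rpow_of_exponent_le hn1 (le_max_left _ _)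
      _ ≤ X ^ τ := Real.rpow_le_rpow (by positivity) hnX
        (le_trans (by norm_num) (le_max_right _ _))
  have hb2 : √X ≤ X ^ τ := by
    rw [Real.sqrt_eq_rpow]
    exact Real.rpow_le_rpow_of_exponent_le hX1 (le_max_right _ _)
  have hb3 : 1 ≤ X ^ τ := Real.one_le_rpow hX1 (le_trans (by norm_num) (le_max_right _ _))
  have hb4 : Real.log X ≤ X ^ ε / ε := Real.log_le_rpow_div (by positivity) hε0
  have hb5 : X / 6 ≤ 3 * X ^ τ * (X ^ ε / ε) := by
    refine hmain.trans (mul_le_mul (by linarith) hb4 (Real.log_nonneg hX1) (by positivity))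
  have hXsplit : X = X ^ τ * X ^ ε * X ^ ε := by
    rw [← Real.rpow_add (by positivity), ← Real.rpow_add (by positivity)]
    rw [show τ + ε + ε = 1 by rw [hε]; ring, Real.rpow_one]
  have hb6 : X ^ ε ≤ 18 / ε := by
    have hpos : 0 < X ^ τ * X ^ ε := by positivity
    have : X ^ τ * X ^ ε * X ^ ε ≤ X ^ τ * X ^ ε * (18 / ε) := by
      rw [← hXsplit]
      have : 3 * X ^ τ * (X ^ ε / ε) * 6 = X ^ τ * X ^ ε * (18 / ε) := by ring
      linarith
    exact le_of_mul_le_mul_left this hpos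
  calc (n : ℝ) ≤ X := hnX
    _ = (X ^ ε) ^ (1 / ε) := by
      rw [← Real.rpow_mul (by positivity), mul_one_div_cancel hε0.ne', Real.rpow_one]
    _ ≤ _ := Real.rpow_le_rpow (by positivity) hb6 (by positivity)

/-! ### Summable decay weights on the frequencies. -/

section

theorem hasSum_zeta_re {β : ℝ} (hβ : 1 < β) :
    HasSum (fun n : ℕ => (n : ℝ) ^ (-β)) (riemannZeta (β : ℂ)).re := by
  have hs : Summable fun n : ℕ => (n : ℝ) ^ (-β) := Real.summable_nat_rpow.2 (by linarith)
  convert hs.hasSum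
  rw [zeta_eq_tsum_one_div_nat_cpow (by simpa using hβ)]
  have : ∀ n : ℕ, 1 / (n : ℂ) ^ (β : ℂ) = (((n : ℝ) ^ (-β) : ℝ) : ℂ) := fun n => by
    rw [Real.rpow_neg (Nat.cast_nonneg n), Complex.ofReal_inv,
      Complex.ofReal_cpow (Nat.cast_nonneg n), one_div]
    simp
  simp_rw [this]
  rw [← Complex.ofReal_tsum, Complex.ofReal_re]

theorem sum_int_rpow_le {β : ℝ} (hβ : 1 < β) (I : Finset ℤ) :
    ∑ a ∈ I, |(a : ℝ)| ^ (-β) ≤ 2 * (riemannZeta (β : ℂ)).re := by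
  have hcast : ∀ a : ℤ, |(a : ℝ)| ^ (-β) = ((a.natAbs : ℕ) : ℝ) ^ (-β) := fun a => by
    rw [Nat.cast_natAbs, Int.cast_abs]
  have key : ∀ J : Finset ℤ, (∀ a ∈ J, ∀ b ∈ J, a.natAbs = b.natAbs → a = b) →
      ∑ a ∈ J, |(a : ℝ)| ^ (-β) ≤ (riemannZeta (β : ℂ)).re := fun J hJ => by
    simp_rw [hcast]
    rw [← Finset.sum_image (f := fun n : ℕ => (n : ℝ) ^ (-β)) (g := Int.natAbs)
      (fun a ha b hb hab => hJ a ha b hb hab)]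
    rw [← (hasSum_zeta_re hβ).tsum_eq]
    exact (hasSum_zeta_re hβ).summable.sum_le_tsum _ fun n _ => by positivity
  rw [← Finset.sum_filter_add_sum_filter_not I (fun a => 0 < a), two_mul]
  refine add_le_add (key _ ?_) (key _ ?_)
  · intro a ha b hb hab
    simp only [Finset.mem_filter] at ha hb
    omega
  · intro a ha b hb hab
    simp only [Finset.mem_filter] at ha hb
    omega

/-- The weight `Γ (supp k) ∏_{j ∈ supp k} |k_j| ^ (-β)`, set to zero at `k = 0`. -/
def decay {d : ℕ} (β : ℝ) (Γ : Finset (Fin d) → ℝ) (k : Fin d → ℤ) : ℝ :=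
  if k = 0 then 0 else Γ (freqSupp k) * ∏ j ∈ freqSupp k, |(k j : ℝ)| ^ (-β)

variable {d : ℕ} {β : ℝ} {Γ : Finset (Fin d) → ℝ}

theorem mem_freqSupp {k : Fin d → ℤ} {j : Fin d} : j ∈ freqSupp k ↔ k j ≠ 0 := by
  simp [freqSupp]

theorem decay_nonneg (hΓ : ∀ u, 0 < Γ u) (k : Fin d → ℤ) : 0 ≤ decay β Γ k := by
  unfold decay
  split_ifs
  · exact le_rfl
  · have := hΓ (freqSupp k)
    positivity

theorem decay_pos (hΓ : ∀ u, 0 < Γ u) {k : Fin d → ℤ} (hk : k ≠ 0) : 0 < decay β Γ k := by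
  rw [decay, if_neg hk]
  refine mul_pos (hΓ _) (Finset.prod_pos fun j hj => Real.rpow_pos_of_pos ?_ _)
  exact abs_pos.2 (Int.cast_ne_zero.2 (mem_freqSupp.1 hj))

/-- Grouping by support `u` and enlarging to a box turns each group into a product of
one-dimensional sums, each at most `2ζ(β)`. -/
theorem sum_decay_le (hβ : 1 < β) (hΓ : ∀ u, 0 < Γ u) (F : Finset (Fin d → ℤ)) :
    ∑ k ∈ F, decay β Γ k ≤ weightSum d β Γ := by
  classical
  let U : Finset (Finset (Fin d)) := Finset.univ.filter Finset.Nonempty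
  let I : Finset ℤ := F.biUnion fun k => Finset.univ.image k
  let t : Finset (Fin d) → Fin d → Finset ℤ := fun u j => if j ∈ u then I.filter (· ≠ 0) else {0}
  have hmaps : ∀ k ∈ F.filter (· ≠ 0), freqSupp k ∈ U := fun k hk => by
    simp only [U, Finset.mem_filter, Finset.mem_univ, true_and]
    obtain ⟨j, hj⟩ := Function.ne_iff.1 (Finset.mem_filter.1 hk).2
    exact ⟨j, mem_freqSupp.2 hj⟩
  have h1 : ∑ k ∈ F, decay β Γ k = ∑ k ∈ F.filter (· ≠ 0), decay β Γ k := by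
    refine (Finset.sum_filter_of_ne fun k _ hk => ?_).symm
    rintro rfl
    simp [decay] at hk
  rw [h1, ← Finset.sum_fiberwise_of_maps_to hmaps, weightSum]
  refine Finset.sum_le_sum fun u _ => ?_
  let g : (Fin d) → ℤ → ℝ := fun j a => if j ∈ u then |(a : ℝ)| ^ (-β) else 1
  have hg0 : ∀ j a, 0 ≤ g j a := fun j a => by simp only [g]; split_ifs <;> positivity
  have hsub : (F.filter (· ≠ 0)).filter (freqSupp · = u) ⊆ Fintype.piFinset (t u) := fun k hk => by
    simp only [Finset.mem_filter] at hk
    obtain ⟨⟨hkF, -⟩, rfl⟩ := hk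
    refine Fintype.mem_piFinset.2 fun j => ?_
    simp only [t]
    split_ifs with hj
    · exact Finset.mem_filter.2 ⟨Finset.mem_biUnion.2 ⟨k, hkF, by simp⟩, mem_freqSupp.1 hj⟩
    · simpa [mem_freqSupp] using hj
  calc ∑ k ∈ (F.filter (· ≠ 0)).filter (freqSupp · = u), decay β Γ k
      = ∑ k ∈ (F.filter (· ≠ 0)).filter (freqSupp · = u), Γ u * ∏ j, g j (k j) := by
        refine Finset.sum_congr rfl fun k hk => ?_
        simp only [Finset.mem_filter] at hk
        obtain ⟨⟨-, hk0⟩, rfl⟩ := hk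
        rw [decay, if_neg hk0]
        congr 1
        simp [g, Finset.prod_ite_mem]
    _ ≤ ∑ k ∈ Fintype.piFinset (t u), Γ u * ∏ j, g j (k j) :=
        Finset.sum_le_sum_of_subset_of_nonneg hsub fun k _ _ =>
          mul_nonneg (hΓ u).le (Finset.prod_nonneg fun j _ => hg0 j _)
    _ = Γ u * ∏ j, ∑ a ∈ t u j, g j a := by rw [← Finset.mul_sum, Finset.prod_univ_sum]
    _ ≤ Γ u * ∏ j, if j ∈ u then 2 * (riemannZeta (β : ℂ)).re else 1 := by
        refine mul_le_mul_of_nonneg_left (Finset.prod_le_prod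
          (fun j _ => Finset.sum_nonneg fun a _ => hg0 j a) fun j _ => ?_) (hΓ u).le
        simp only [t, g]
        split_ifs with hj
        · exact sum_int_rpow_le hβ _
        · simp
    _ = Γ u * (2 * (riemannZeta (β : ℂ)).re) ^ u.card := by simp [Finset.prod_ite_mem]

theorem summable_decay (hβ : 1 < β) (hΓ : ∀ u, 0 < Γ u) : Summable (decay β Γ) :=
  summable_of_sum_le (fun k => decay_nonneg hΓ k) fun F => sum_decay_le hβ hΓ F

theorem tsum_decay_le (hβ : 1 < β) (hΓ : ∀ u, 0 < Γ u) :
    ∑' k, decay β Γ k ≤ weightSum d β Γ :=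
  Real.tsum_le_of_sum_le (fun k => decay_nonneg hΓ k) fun F => sum_decay_le hβ hΓ F

theorem weightSum_pos (hd : 1 ≤ d) (hβ : 1 < β) (hΓ : ∀ u, 0 < Γ u) : 0 < weightSum d β Γ := by
  have hk : (fun _ => 1 : Fin d → ℤ) ≠ 0 := fun h => by
    have := congrFun h ⟨0, hd⟩
    simp at this
  have := sum_decay_le hβ hΓ {fun _ => 1}
  rw [Finset.sum_singleton] at this
  exact (decay_pos hΓ hk).trans_le this

/-- Since `β > 1`, the factor `|k_j|` is absorbed by `|k_j|^(-β)`, leaving at most `Γ (supp k)`.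
That is the decay at the sign vector of `k`, a single term of the total. This limits the entries of
`k`, hence their prime divisors. -/
theorem abs_mul_decay_le (hβ : 1 < β) (hΓ : ∀ u, 0 < Γ u) (k : Fin d → ℤ) (j : Fin d) :
    |(k j : ℝ)| * decay β Γ k ≤ weightSum d β Γ := by
  classical
  by_cases hj : k j = 0
  · have := (Finset.sum_nonneg fun k _ => decay_nonneg hΓ k).trans (sum_decay_le hβ hΓ {0})
    simpa [hj] using this
  have hk : k ≠ 0 := fun h => hj (by simp [h])
  have hj' := mem_freqSupp.2 hj
  have hge : ∀ i ∈ freqSupp k, 1 ≤ |(k i : ℝ)| := fun i hi => by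
    exact_mod_cast Int.one_le_abs (mem_freqSupp.1 hi)
  have h1 : |(k j : ℝ)| * ∏ i ∈ freqSupp k, |(k i : ℝ)| ^ (-β) ≤ 1 := by
    rw [← Finset.mul_prod_erase _ _ hj', ← mul_assoc]
    refine mul_le_one₀ ?_ (Finset.prod_nonneg fun i _ => by positivity)
      (Finset.prod_le_one (fun i _ => by positivity) fun i hi =>
        Real.rpow_le_one_of_one_le_of_nonpos (hge i (Finset.mem_of_mem_erase hi)) (by linarith))
    have h0 : 0 < |(k j : ℝ)| := by linarith [hge j hj']
    calc |(k j : ℝ)| * |(k j : ℝ)| ^ (-β) = |(k j : ℝ)| ^ (1 + -β) := by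
          rw [Real.rpow_add h0, Real.rpow_one]
      _ ≤ 1 := Real.rpow_le_one_of_one_le_of_nonpos (hge j hj') (by linarith)
  have hsupp : freqSupp (fun i => (k i).sign) = freqSupp k := by
    ext i; simp [mem_freqSupp]
  have h2 : decay β Γ (fun i => (k i).sign) = Γ (freqSupp k) := by
    rw [decay, if_neg, hsupp, Finset.prod_eq_one, mul_one]
    · intro i hi
      rcases lt_or_gt_of_ne (mem_freqSupp.1 hi) with h | h
      · simp [Int.sign_eq_neg_one_of_neg h]
      · simp [Int.sign_eq_one_of_pos h]
    · intro h
      have := congrFun h j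
      simp [hj] at this
  have h3 := sum_decay_le hβ hΓ {fun i => (k i).sign}
  rw [Finset.sum_singleton, h2] at h3
  refine le_trans ?_ h3
  rw [decay, if_neg hk, mul_left_comm]
  exact mul_le_of_le_one_right (hΓ _).le h1

/-- Each nonzero entry contributes `p^(-β) ≤ 1/p`, and for `m ≠ 0` there is at least one. -/
theorem decay_mul_le (hβ : 1 < β) (hΓ : ∀ u, 0 < Γ u) {p : ℕ} (hp : 1 ≤ p) (m : Fin d → ℤ) :
    decay β Γ (fun j => p * m j) ≤ (p : ℝ)⁻¹ * decay β Γ m := by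
  have hp0 : (p : ℤ) ≠ 0 := by exact_mod_cast (by omega : p ≠ 0)
  by_cases hm : m = 0
  · simp [decay, hm]; simp [Pi.zero_def]
  obtain ⟨j, hj⟩ := Function.ne_iff.1 hm
  have hj : m j ≠ 0 := hj
  have hpm : (fun j => (p : ℤ) * m j) ≠ 0 := fun h => by
    have := congrFun h j
    simp only [Pi.zero_apply, mul_eq_zero, hp0, hj, or_self] at this
  have hsupp : freqSupp (fun j => (p : ℤ) * m j) = freqSupp m := by
    ext i; simp only [mem_freqSupp, ne_eq, mul_eq_zero, hp0, false_or]
  have hp1 : (1 : ℝ) ≤ p := by exact_mod_cast hp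
  have hle : (p : ℝ) ^ (-β) ≤ (p : ℝ)⁻¹ := by
    rw [← Real.rpow_neg_one]
    exact Real.rpow_le_rpow_of_exponent_le hp1 (by linarith)
  have hle1 : (p : ℝ) ^ (-β) ≤ 1 := Real.rpow_le_one_of_one_le_of_nonpos hp1 (by linarith)
  have hprod : ∏ i ∈ freqSupp m, |(((p : ℤ) * m i : ℤ) : ℝ)| ^ (-β) =
      ((p : ℝ) ^ (-β)) ^ (freqSupp m).card * ∏ i ∈ freqSupp m, |(m i : ℝ)| ^ (-β) := by
    rw [← Finset.prod_const, ← Finset.prod_mul_distrib]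
    refine Finset.prod_congr rfl fun i _ => ?_
    rw [Int.cast_mul, abs_mul, Real.mul_rpow (abs_nonneg _) (abs_nonneg _)]
    simp
  have hcard : 1 ≤ (freqSupp m).card := Finset.card_pos.2 ⟨j, mem_freqSupp.2 hj⟩
  have hpow : ((p : ℝ) ^ (-β)) ^ (freqSupp m).card ≤ (p : ℝ)⁻¹ :=
    (pow_le_of_le_one (by positivity) hle1 (by omega)).trans hle
  rw [decay, if_neg hpm, decay, if_neg hm, hsupp, hprod, mul_left_comm]
  refine mul_le_mul_of_nonneg_right hpow (mul_nonneg (hΓ _).le ?_)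
  exact Finset.prod_nonneg fun i _ => by positivity

open Classical in
theorem tsum_decay_dvd_le (hβ : 1 < β) (hΓ : ∀ u, 0 < Γ u) {p : ℕ} (hp : 1 ≤ p) :
    ∑' k : Fin d → ℤ, (if ∀ j, (p : ℤ) ∣ k j then decay β Γ k else 0) ≤ weightSum d β Γ / p := by
  refine Real.tsum_le_of_sum_le (fun k => ?_) fun F => ?_
  · show 0 ≤ ite _ _ _
    split_ifs
    exacts [decay_nonneg hΓ k, le_rfl]
  rw [← Finset.sum_filter]
  have hdiv : ∀ k ∈ F.filter (fun k => ∀ j, (p : ℤ) ∣ k j), (fun j => (p : ℤ) * (k j / p)) = k :=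
    fun k hk => funext fun j => Int.mul_ediv_cancel' ((Finset.mem_filter.1 hk).2 j)
  have hinj : Set.InjOn (fun (k : Fin d → ℤ) j => k j / (p : ℤ))
      (F.filter (fun k => ∀ j, (p : ℤ) ∣ k j) : Finset _) := fun k hk l hl hkl => by
    rw [← hdiv k hk, ← hdiv l hl]
    funext j
    have := congrFun hkl j
    simp only at this
    rw [this]
  calc ∑ k ∈ F.filter (fun k => ∀ j, (p : ℤ) ∣ k j), decay β Γ k
      ≤ ∑ k ∈ F.filter (fun k => ∀ j, (p : ℤ) ∣ k j), (p : ℝ)⁻¹ * decay β Γ (fun j => k j / p) := by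
        refine Finset.sum_le_sum fun k hk => ?_
        conv_lhs => rw [← hdiv k hk]
        exact decay_mul_le hβ hΓ hp _
    _ = (p : ℝ)⁻¹ * ∑ m ∈ (F.filter (fun k => ∀ j, (p : ℤ) ∣ k j)).image
          (fun k j => k j / (p : ℤ)), decay β Γ m := by
        rw [Finset.sum_image hinj, Finset.mul_sum]
    _ ≤ (p : ℝ)⁻¹ * weightSum d β Γ :=
        mul_le_mul_of_nonneg_left (sum_decay_le hβ hΓ _) (by positivity)
    _ = weightSum d β Γ / p := by rw [div_eq_inv_mul]

/-! ### Probability that a frequency is dual. -/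

/-- `k` lies in the dual lattice of the rule with `ω.1` points and generating vector `ω.2`. -/
def InDual (ω : Draw d) (k : Fin d → ℤ) : Prop := (ω.1 : ℤ) ∣ ∑ j, k j * (ω.2 j : ℤ)

open Classical in
-- As `p` does not divide `k i`, the congruence determines `z i` from the other entries. Overwriting
-- `z i` by 1 is therefore injective on the solutions.
theorem card_genVectors_inDual_le {p : ℕ} (hp : p.Prime) {k : Fin d → ℤ} {i : Fin d}
    (hi : ¬ (p : ℤ) ∣ k i) :
    ((genVectors d p).filter fun z => InDual ⟨p, z⟩ k).card * (p - 1) ≤ (p - 1) ^ d := by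
  have hcard : ((genVectors d p).filter fun z => InDual ⟨p, z⟩ k).card ≤
      (Fintype.piFinset fun j => if j = i then {1} else Finset.Icc 1 (p - 1)).card := by
    refine Finset.card_le_card_of_injOn (fun z => Function.update z i 1) ?_ ?_
    · intro z hz
      simp only [Finset.coe_filter, Set.mem_ofPred_eq, genVectors, Fintype.mem_piFinset] at hz
      refine Finset.mem_coe.2 (Fintype.mem_piFinset.2 fun j => ?_)
      by_cases hj : j = i
      · subst hj; simp
      · simpa [hj] using hz.1 j
    · intro z hz y hy hzy
      simp only [Finset.coe_filter, Set.mem_ofPred_eq, genVectors, Fintype.mem_piFinset,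
        InDual] at hz hy
      have hne : ∀ j, j ≠ i → z j = y j := fun j hj => by
        have := congrFun hzy j
        simpa [hj] using this
      have hdvd := dvd_sub hz.2 hy.2
      rw [← Finset.sum_sub_distrib, Finset.sum_eq_single i
        (fun j _ hj => by rw [hne j hj, sub_self]) (by simp), ← mul_sub] at hdvd
      have h1 := ((Nat.prime_iff_prime_int.1 hp).dvd_or_dvd hdvd).resolve_left hi
      have hzi := Finset.mem_Icc.1 (hz.1 i)
      have hyi := Finset.mem_Icc.1 (hy.1 i)
      have h2 : ((z i : ℤ) - y i) = 0 := by
        refine Int.eq_zero_of_abs_lt_dvd h1 ?_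
        rw [abs_lt]
        omega
      funext j
      by_cases hj : j = i
      · subst hj; omega
      · exact hne j hj
  refine (Nat.mul_le_mul_right _ hcard).trans (le_of_eq ?_)
  rw [Fintype.card_piFinset, ← Finset.mul_prod_erase _ _ (Finset.mem_univ i)]
  have : ∏ j ∈ Finset.univ.erase i, (if j = i then {1} else Finset.Icc 1 (p - 1)).card =
      ∏ j ∈ Finset.univ.erase i, (p - 1) :=
    Finset.prod_congr rfl fun j hj => by simp [Finset.ne_of_mem_erase hj]
  rw [this, Finset.prod_const, Finset.card_erase_of_mem (Finset.mem_univ i), Finset.card_univ,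
    Fintype.card_fin, if_pos rfl, Finset.card_singleton, one_mul, ← pow_succ,
    Nat.sub_add_cancel (by have := i.2; omega)]

open Classical in
/-- The number of primes in `primeRange n` dividing all entries of `k`. -/
def numDvd (n : ℕ) (k : Fin d → ℤ) : ℕ := ((primeRange n).filter fun p : ℕ => ∀ j, (p : ℤ) ∣ k j).card

theorem half_le_of_mem_primeRange {n p : ℕ} (hp : p ∈ primeRange n) : (n : ℝ) / 2 ≤ p - 1 := by
  have h1 := (mem_primeRange.1 hp).1.1
  have : (n : ℝ) + 2 ≤ 2 * p := by exact_mod_cast (by omega : n + 2 ≤ 2 * p)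
  linarith

open Classical in
-- Given `p`, the probability is at most `1/(p-1) ≤ 2/n` unless `p` divides all of `k`, when it is
-- bounded by 1.
theorem drawExp_inDual_le {n : ℕ} (hn : 2 ≤ n) (k : Fin d → ℤ) :
    drawExp n d (fun ω => if InDual ω k then 1 else 0) ≤
      2 / n + numDvd n k / (primeRange n).card := by
  have hP : (0 : ℝ) < (primeRange n).card := by exact_mod_cast (primeRange_nonempty hn).card_pos
  have hn0 : (0 : ℝ) < n := by exact_mod_cast (by omega : 0 < n)
  have hp : ∀ p ∈ primeRange n, 1 / ((genVectors d p).card : ℝ) *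
      ∑ z ∈ genVectors d p, (if InDual ⟨p, z⟩ k then (1 : ℝ) else 0) ≤
        2 / n + if ∀ j, (p : ℤ) ∣ k j then 1 else 0 := fun p hp => by
    have hG : (0 : ℝ) < (genVectors d p).card := by exact_mod_cast card_genVectors_pos hp
    rw [Finset.sum_boole, one_div_mul_eq_div]
    split_ifs with hk
    · have h1 : (((genVectors d p).filter fun z => InDual ⟨p, z⟩ k).card : ℝ) /
          (genVectors d p).card ≤ 1 := by
        rw [div_le_one hG]
        exact_mod_cast Finset.card_filter_le _ _
      have : (0 : ℝ) ≤ 2 / n := by positivity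
      linarith
    · push Not at hk
      obtain ⟨i, hi⟩ := hk
      have h1 := card_genVectors_inDual_le (mem_primeRange.1 hp).2 hi
      rw [← card_genVectors] at h1
      have h2 : (((genVectors d p).filter fun z => InDual ⟨p, z⟩ k).card : ℝ) * (p - 1) ≤
          (genVectors d p).card := by
        have h3 : ((p - 1 : ℕ) : ℝ) = (p : ℝ) - 1 := by
          rw [Nat.cast_sub (mem_primeRange.1 hp).2.one_lt.le, Nat.cast_one]
        rw [← h3]
        exact_mod_cast h1
      have h4 := half_le_of_mem_primeRange hp
      rw [add_zero, div_le_div_iff₀ hG hn0]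
      have h5 : (0 : ℝ) ≤ ((genVectors d p).filter fun z => InDual ⟨p, z⟩ k).card := by positivity
      nlinarith [mul_le_mul_of_nonneg_left h4 h5]
  rw [drawExp_eq]
  calc _ ≤ 1 / ((primeRange n).card : ℝ) *
        ∑ p ∈ primeRange n, (2 / (n : ℝ) + if ∀ j, (p : ℤ) ∣ k j then 1 else 0) :=
        mul_le_mul_of_nonneg_left (Finset.sum_le_sum hp) (by positivity)
    _ = 2 / n + numDvd n k / (primeRange n).card := by
        rw [Finset.sum_add_distrib, Finset.sum_boole, numDvd]
        simp only [Finset.sum_const, nsmul_eq_mul]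
        field_simp

open Classical in
theorem drawExp_tsum (n : ℕ) {a : (Fin d → ℤ) → ℝ} (ha : ∀ k, 0 ≤ a k) (hs : Summable a) :
    (Summable fun k => a k * drawExp n d (fun ω => if InDual ω k then 1 else 0)) ∧
    drawExp n d (fun ω => ∑' k, if InDual ω k then a k else 0) =
      ∑' k, a k * drawExp n d (fun ω => if InDual ω k then 1 else 0) := by
  have hsω : ∀ ω : Draw d, Summable fun k => if InDual ω k then a k else 0 := fun ω =>
    hs.of_nonneg_of_le (fun k => by split_ifs; exacts [ha k, le_rfl])
      (fun k => by split_ifs; exacts [le_rfl, ha k])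
  have heq : ∀ k, a k * drawExp n d (fun ω => if InDual ω k then 1 else 0) =
      ∑ ω ∈ draws n d, drawProb n d ω * if InDual ω k then a k else 0 := fun k => by
    rw [drawExp, Finset.mul_sum]
    exact Finset.sum_congr rfl fun ω _ => by split_ifs <;> ring
  have hs' : ∀ ω ∈ draws n d, Summable fun k => drawProb n d ω * if InDual ω k then a k else 0 :=
    fun ω _ => (hsω ω).mul_left _
  simp_rw [heq]
  refine ⟨summable_sum hs', ?_⟩
  rw [Summable.tsum_finsetSum hs', drawExp]
  exact Finset.sum_congr rfl fun ω _ => tsum_mul_left.symm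

open Classical in
-- The two terms of `drawExp_inDual_le` give `2V/n` each; for the second, the multiples of `p` carry
-- total decay at most `V/p ≤ 2V/n`.
theorem drawExp_tsum_decay_le {n : ℕ} (hn : 2 ≤ n) (hβ : 1 < β) (hΓ : ∀ u, 0 < Γ u) :
    drawExp n d (fun ω => ∑' k, if InDual ω k then decay β Γ k else 0) ≤
      4 * weightSum d β Γ / n := by
  have hP : (0 : ℝ) < (primeRange n).card := by exact_mod_cast (primeRange_nonempty hn).card_pos
  have hn0 : (0 : ℝ) < n := by exact_mod_cast (by omega : 0 < n)
  have hW := decay_nonneg (β := β) hΓ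
  have hs := summable_decay (d := d) hβ hΓ
  have hV : 0 ≤ weightSum d β Γ := (tsum_nonneg hW).trans (tsum_decay_le hβ hΓ)
  obtain ⟨h1, h2⟩ := drawExp_tsum n hW hs
  rw [h2]
  have hsp : ∀ p ∈ primeRange n, Summable fun k : Fin d → ℤ =>
      if ∀ j, (p : ℤ) ∣ k j then decay β Γ k else 0 := fun p _ =>
    hs.of_nonneg_of_le (fun k => by split_ifs; exacts [hW k, le_rfl])
      (fun k => by split_ifs; exacts [le_rfl, hW k])
  have heq : ∀ k : Fin d → ℤ, decay β Γ k * (2 / n + numDvd n k / (primeRange n).card) =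
      2 / n * decay β Γ k + 1 / ((primeRange n).card : ℝ) * ∑ p ∈ primeRange n,
        (if ∀ j, (p : ℤ) ∣ k j then decay β Γ k else 0) := fun k => by
    rw [← Finset.sum_filter, Finset.sum_const, numDvd, nsmul_eq_mul]
    ring
  have hs2 : Summable fun k : Fin d → ℤ =>
      2 / n * decay β Γ k + 1 / ((primeRange n).card : ℝ) * ∑ p ∈ primeRange n,
        (if ∀ j, (p : ℤ) ∣ k j then decay β Γ k else 0) :=
    (hs.mul_left _).add ((summable_sum hsp).mul_left _)
  calc _ ≤ ∑' k : Fin d → ℤ, (2 / n * decay β Γ k + 1 / ((primeRange n).card : ℝ) *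
        ∑ p ∈ primeRange n, (if ∀ j, (p : ℤ) ∣ k j then decay β Γ k else 0)) :=
        h1.tsum_le_tsum (fun k => by
          rw [← heq]; exact mul_le_mul_of_nonneg_left (drawExp_inDual_le hn k) (hW k)) hs2
    _ = 2 / n * ∑' k, decay β Γ k + 1 / ((primeRange n).card : ℝ) * ∑ p ∈ primeRange n,
          ∑' k : Fin d → ℤ, (if ∀ j, (p : ℤ) ∣ k j then decay β Γ k else 0) := by
        rw [Summable.tsum_add (hs.mul_left _) ((summable_sum hsp).mul_left _), tsum_mul_left,
          tsum_mul_left, Summable.tsum_finsetSum hsp]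
    _ ≤ 2 / n * weightSum d β Γ + 1 / ((primeRange n).card : ℝ) * ∑ p ∈ primeRange n,
          2 / n * weightSum d β Γ := by
        gcongr with p hp
        · exact tsum_decay_le hβ hΓ
        · have hp1 := half_le_of_mem_primeRange hp
          refine (tsum_decay_dvd_le hβ hΓ (mem_primeRange.1 hp).2.one_lt.le).trans ?_
          rw [div_mul_eq_mul_div, div_le_div_iff₀ (by linarith) hn0]
          nlinarith
    _ = 4 * weightSum d β Γ / n := by
        rw [Finset.sum_const, nsmul_eq_mul]
        field_simp
        ring

end

/-! ### Lattice rules acting on Fourier series. -/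

section

variable {d : ℕ}

theorem expChar_fract (k : Fin d → ℤ) (y : Fin d → ℝ) :
    expChar k (fun j => Int.fract (y j)) = expChar k y := by
  unfold expChar
  rw [Complex.exp_eq_exp_iff_exists_int]
  refine ⟨-∑ j, k j * ⌊y j⌋, ?_⟩
  have : ∑ j, (k j : ℝ) * Int.fract (y j) = ∑ j, (k j : ℝ) * y j - ((∑ j, k j * ⌊y j⌋ : ℤ) : ℝ) := by
    push_cast
    rw [← Finset.sum_sub_distrib]
    exact Finset.sum_congr rfl fun j _ => by rw [Int.fract]; ring
  rw [this]
  push_cast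
  ring

open Classical in
theorem latticeRule_expChar {p : ℕ} (hp : 0 < p) (z : Fin d → ℕ) (k : Fin d → ℤ) :
    latticeRule p z (expChar k) = if InDual ⟨p, z⟩ k then 1 else 0 := by
  have hp0 : (p : ℂ) ≠ 0 := by exact_mod_cast hp.ne'
  set s : ℤ := ∑ j, k j * (z j : ℤ) with hs
  set ξ : ℂ := Complex.exp (2 * Real.pi * Complex.I * (s / p)) with hξ
  have hterm : ∀ i : ℕ, expChar k (fun j => Int.fract ((i : ℝ) * (z j : ℝ) / (p : ℝ))) = ξ ^ i := by
    intro i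
    rw [expChar_fract, hξ, ← Complex.exp_nat_mul, expChar, hs]
    congr 1
    push_cast
    rw [Finset.sum_div, Finset.mul_sum, Finset.mul_sum, Finset.mul_sum]
    exact Finset.sum_congr rfl fun j _ => by ring
  unfold latticeRule
  simp_rw [hterm]
  have hdual : InDual ⟨p, z⟩ k ↔ (p : ℤ) ∣ s := Iff.rfl
  have hone : ξ = 1 ↔ (p : ℤ) ∣ s := by
    rw [hξ, Complex.exp_eq_one_iff]
    constructor
    · rintro ⟨m, hm⟩
      rw [mul_comm (m : ℂ)] at hm
      have h1 := mul_left_cancel₀ Complex.two_pi_I_ne_zero hm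
      rw [div_eq_iff hp0] at h1
      exact ⟨m, by rw [mul_comm]; exact_mod_cast h1⟩
    · rintro ⟨m, hm⟩
      refine ⟨m, ?_⟩
      rw [hm]
      push_cast
      field_simp
  split_ifs with h
  · rw [hone.2 (hdual.1 h)]
    simp [hp0]
  · have hne : ξ ≠ 1 := fun h1 => h (hdual.2 (hone.1 h1))
    have hpow : ξ ^ p = 1 := by
      rw [hξ, ← Complex.exp_nat_mul, Complex.exp_eq_one_iff]
      refine ⟨s, ?_⟩
      field_simp
    rw [geom_sum_eq hne, hpow]
    simp

theorem cubeIntegral_eq_fourierCoeffCube_zero (f : (Fin d → ℝ) → ℂ) :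
    cubeIntegral f = fourierCoeffCube f 0 := by
  simp [fourierCoeffCube, expChar]

open Classical in
/-- The error of a lattice rule is the sum of the Fourier coefficients over the nonzero elements of
the dual lattice. -/
theorem hasSum_latticeRule_sub {α : ℝ} {γ : Finset (Fin d) → ℝ} {f : (Fin d → ℝ) → ℂ}
    (hf : MemKorobov α γ f) {p : ℕ} (hp : 0 < p) (z : Fin d → ℕ) :
    HasSum (fun k => if k ≠ 0 ∧ InDual ⟨p, z⟩ k then fourierCoeffCube f k else 0)
      (latticeRule p z f - cubeIntegral f) := by
  have h1 : HasSum (fun k => fourierCoeffCube f k * if InDual ⟨p, z⟩ k then 1 else 0)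
      (latticeRule p z f) := by
    have h2 := (hasSum_sum (s := Finset.range p) fun i _ => hf.hasSum_fourier
      (fun j => Int.fract ((i : ℝ) * (z j : ℝ) / (p : ℝ)))
      ⟨fun j => Int.fract_nonneg _, fun j => (Int.fract_lt_one _).le⟩).mul_left (1 / (p : ℂ))
    refine h2.congr_fun ?_
    intro k
    rw [← latticeRule_expChar hp, latticeRule, ← Finset.mul_sum]
    ring
  rw [cubeIntegral_eq_fourierCoeffCube_zero]
  refine (h1.sub (hasSum_ite_eq 0 (fourierCoeffCube f 0))).congr_fun fun k => ?_
  by_cases hk : k = 0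
  · subst hk
    simp [InDual]
  · simp [hk]

end

/-! ### Error bounds for a single lattice rule. -/

section

variable {d : ℕ} {β : ℝ} {Γ : Finset (Fin d) → ℝ}

/-- The product of the counted primes divides `k j`. One of them is bounded below by `n/2`, the
others only by 2, which suffices for a logarithmic bound on their number. -/
theorem half_mul_two_pow_numDvd_le {n : ℕ} {k : Fin d → ℤ} {j : Fin d} (hj : k j ≠ 0)
    (h : 1 ≤ numDvd n k) : (n : ℝ) / 2 * 2 ^ (numDvd n k - 1) ≤ |(k j : ℝ)| := by
  classical
  rw [numDvd] at h ⊢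
  set Q := (primeRange n).filter fun p : ℕ => ∀ j, (p : ℤ) ∣ k j with hQ
  obtain ⟨q, hq⟩ := Finset.card_pos.1 h
  have hmem : ∀ p ∈ Q, p ∈ primeRange n := fun p hp => (Finset.mem_filter.1 hp).1
  have hdvd : ∏ p ∈ Q, p ∣ (k j).natAbs :=
    Finset.prod_primes_dvd _ (fun p hp => (mem_primeRange.1 (hmem p hp)).2.prime)
      fun p hp => Int.natCast_dvd.1 ((Finset.mem_filter.1 hp).2 j)
  have hle := Nat.le_of_dvd (Int.natAbs_pos.2 hj) hdvd
  rw [← Finset.mul_prod_erase _ _ hq] at hle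
  have h2 : 2 ^ (Q.card - 1) ≤ ∏ p ∈ Q.erase q, p := by
    rw [← Finset.card_erase_of_mem hq]
    exact Finset.pow_card_le_prod _ _ _ fun p hp =>
      (mem_primeRange.1 (hmem p (Finset.mem_of_mem_erase hp))).2.two_le
  have h3 : ((q * 2 ^ (Q.card - 1) : ℕ) : ℝ) ≤ |(k j : ℝ)| := by
    rw [← Int.cast_abs, ← Nat.cast_natAbs]
    exact_mod_cast (Nat.mul_le_mul_left _ h2).trans hle
  refine le_trans ?_ h3
  push_cast
  have := half_le_of_mem_primeRange (hmem q hq)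
  gcongr
  linarith

/-- Let `y` be the base of the power on the right. Many common prime divisors force a large entry,
hence small decay: `2^(numDvd - 1) ≤ y`. Then `log y ≤ y^η / η` turns the logarithm into an
arbitrarily small power. -/
theorem numDvd_le_rpow {n : ℕ} (hn : 2 ≤ n) (hβ : 1 < β) (hΓ : ∀ u, 0 < Γ u) {η : ℝ} (hη : 0 < η)
    {k : Fin d → ℤ} (hk : k ≠ 0) (hs : decay β Γ k ≤ 64 * weightSum d β Γ / n) :
    ((max 1 (numDvd n k) : ℕ) : ℝ) ≤
      (1 + 1 / (η * Real.log 2)) * (64 * weightSum d β Γ / n / decay β Γ k) ^ η := by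
  obtain ⟨j, hj⟩ := Function.ne_iff.1 hk
  have hW := decay_pos (β := β) hΓ hk
  have hn0 : (0 : ℝ) < n := by exact_mod_cast (by omega : 0 < n)
  have hlog : 0 < Real.log 2 := Real.log_pos (by norm_num)
  set V := weightSum d β Γ
  set y := 64 * V / n / decay β Γ k with hy
  have hy1 : 1 ≤ y := by rw [hy, one_le_div hW]; exact hs
  have hyη : 1 ≤ y ^ η := Real.one_le_rpow hy1 hη.le
  have hy0 : 0 < y := by linarith
  suffices hmain : ((max 1 (numDvd n k) : ℕ) : ℝ) ≤ 1 + y ^ η / (η * Real.log 2) by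
    refine hmain.trans ?_
    rw [add_mul, one_mul, one_div_mul_eq_div]
    gcongr
  rcases Nat.lt_or_ge (numDvd n k) 1 with h | h
  · rw [max_eq_left h.le]
    have : 0 ≤ y ^ η / (η * Real.log 2) := by positivity
    simpa using this
  rw [max_eq_right h]
  have h1 := half_mul_two_pow_numDvd_le hj h
  have h2 := abs_mul_decay_le hβ hΓ k j
  have h3 : (2 : ℝ) ^ (numDvd n k - 1) ≤ y := by
    have h4 : (n : ℝ) / 2 * 2 ^ (numDvd n k - 1) * decay β Γ k ≤ V :=
      (mul_le_mul_of_nonneg_right h1 hW.le).trans h2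
    have h5 : V = y * decay β Γ k * n / 64 := by
      rw [hy]; field_simp
    have h6 : (2 : ℝ) ^ (numDvd n k - 1) * (n * decay β Γ k) ≤ y / 32 * (n * decay β Γ k) := by
      rw [h5] at h4
      linarith
    have := le_of_mul_le_mul_right h6 (by positivity)
    linarith
  have h7 := Real.log_le_log (by positivity) h3
  rw [Real.log_pow, Nat.cast_sub h, Nat.cast_one] at h7
  have h8 : ((numDvd n k : ℝ) - 1) * Real.log 2 ≤ y ^ η / η :=
    h7.trans (Real.log_le_rpow_div hy0.le hη)
  have h9 : (numDvd n k : ℝ) - 1 ≤ y ^ η / η / Real.log 2 := (le_div_iff₀ hlog).2 h8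
  rw [div_div] at h9
  linarith

theorem decay_rpow_mul_korobovR {α lam : ℝ} (hlam : 0 < lam) {γ : Finset (Fin d) → ℝ}
    (hγ : ∀ u, 0 < γ u) {k : Fin d → ℤ} (hk : k ≠ 0) :
    decay (α / lam) (fun u => γ u ^ (1 / lam)) k ^ lam * korobovR α γ k = 1 := by
  have hpos : ∀ i ∈ freqSupp k, 0 < |(k i : ℝ)| := fun i hi =>
    abs_pos.2 (Int.cast_ne_zero.2 (mem_freqSupp.1 hi))
  have h1 : (∏ i ∈ freqSupp k, |(k i : ℝ)| ^ (-(α / lam))) ^ lam =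
      (∏ i ∈ freqSupp k, |(k i : ℝ)| ^ α)⁻¹ := by
    rw [← Real.finsetProd_rpow _ _ fun i _ => by positivity, ← Finset.prod_inv_distrib]
    refine Finset.prod_congr rfl fun i hi => ?_
    rw [← Real.rpow_mul (abs_nonneg _), ← Real.rpow_neg (abs_nonneg _)]
    congr 1
    field_simp
  have hprod : 0 < ∏ i ∈ freqSupp k, |(k i : ℝ)| ^ α :=
    Finset.prod_pos fun i hi => Real.rpow_pos_of_pos (hpos i hi) _
  rw [decay, if_neg hk, Real.mul_rpow (by have := hγ (freqSupp k); positivity)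
    (Finset.prod_nonneg fun i _ => by positivity), h1, ← Real.rpow_mul (hγ _).le,
    one_div_mul_cancel hlam.ne', Real.rpow_one, korobovR]
  have := hγ (freqSupp k)
  field_simp

/-- Cauchy-Schwarz for a partial Fourier series, with an auxiliary weight `c`. -/
theorem norm_le_of_hasSum {ι : Type*} {g : ι → ℂ} {s : ℂ} {D : ι → Prop} [DecidablePred D]
    (hs : HasSum (fun k => if D k then g k else 0) s) {b v c : ι → ℝ}
    (hc : ∀ k, 0 < c k) (hg : ∀ k, D k → ‖g k‖ ≤ v k * b k) {U Y r : ℝ}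
    (hU : ∀ F : Finset ι, ∑ k ∈ F.filter D, b k ^ 2 / c k ≤ U)
    (hY : ∀ F : Finset ι, ∑ k ∈ F.filter D, c k * v k ^ 2 ≤ Y)
    (hr : 0 ≤ r) (hUY : U * Y ≤ r ^ 2) : ‖s‖ ≤ r := by
  refine le_of_tendsto' hs.norm fun F => ?_
  have hY0 : 0 ≤ Y := by simpa using hY ∅
  have h1 : ‖∑ k ∈ F, if D k then g k else 0‖ ≤ ∑ k ∈ F.filter D, v k * b k := by
    rw [← Finset.sum_filter]
    exact (norm_sum_le _ _).trans (Finset.sum_le_sum fun k hk => hg k (Finset.mem_filter.1 hk).2)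
  refine h1.trans (le_of_abs_le (abs_le_of_sq_le_sq ?_ hr))
  have h2 := Finset.sum_sq_le_sum_mul_sum_of_sq_le_mul (F.filter D)
    (r := fun k => v k * b k) (f := fun k => b k ^ 2 / c k) (g := fun k => c k * v k ^ 2)
    (fun k _ => div_nonneg (sq_nonneg _) (hc k).le)
    (fun k _ => mul_nonneg (hc k).le (sq_nonneg _))
    fun k _ => le_of_eq (by have := (hc k).ne'; field_simp)
  refine h2.trans (le_trans ?_ hUY)
  refine mul_le_mul (hU F) (hY F) (Finset.sum_nonneg fun k _ =>
    mul_nonneg (hc k).le (sq_nonneg _)) ?_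
  simpa using hU ∅

open Classical in
theorem drawExp_indicator_le {n : ℕ} {g : Draw d → ℝ}
    (h : ∀ ω ∈ draws n d, 0 ≤ g ω) {M : ℝ} (hM : drawExp n d g ≤ M) :
    drawExp n d (fun ω => if 16 * M < g ω then 1 else 0) ≤ 1 / 16 := by
  have hM0 := (drawExp_nonneg h).trans hM
  -- Markov's inequality is void for `M = 0`; then `g` vanishes on every draw of nonzero
  -- probability.
  rcases hM0.eq_or_lt with hM0 | hM0
  · subst hM0
    have hz := (Finset.sum_eq_zero_iff_of_nonneg fun ω hω =>
      mul_nonneg (drawProb_nonneg n d ω) (h ω hω)).1 (le_antisymm hM (drawExp_nonneg h))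
    refine le_trans (le_of_eq ?_) (by norm_num : (0 : ℝ) ≤ 1 / 16)
    refine Finset.sum_eq_zero fun ω hω => ?_
    rcases mul_eq_zero.1 (hz ω hω) with h0 | h0
    · rw [h0, zero_mul]
    · simp [h0]
  · have := (markov_drawExp h (16 * M)).trans hM
    have h2 : M * (16 * drawExp n d (fun ω => if 16 * M < g ω then 1 else 0)) ≤ M * 1 := by
      linarith
    linarith [le_of_mul_le_mul_left h2 hM0]

theorem decay_le_weightSum (hβ : 1 < β) (hΓ : ∀ u, 0 < Γ u) (k : Fin d → ℤ) :
    decay β Γ k ≤ weightSum d β Γ := by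
  simpa using sum_decay_le hβ hΓ {k}

theorem sum_decay_rpow_le (hβ : 1 < β) (hΓ : ∀ u, 0 < Γ u) {τ : ℝ} (hτ : 1 < τ)
    (F : Finset (Fin d → ℤ)) : ∑ k ∈ F, decay β Γ k ^ τ ≤ weightSum d β Γ ^ τ := by
  have hV : 0 ≤ weightSum d β Γ := (decay_nonneg hΓ 0).trans (decay_le_weightSum hβ hΓ 0)
  have hsplit : ∀ x : ℝ, 0 ≤ x → x ^ τ = x ^ (τ - 1) * x := fun x hx => by
    rw [← Real.rpow_add_one' hx (by linarith)]
    congr 1; ring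
  rw [hsplit _ hV]
  calc ∑ k ∈ F, decay β Γ k ^ τ ≤ ∑ k ∈ F, weightSum d β Γ ^ (τ - 1) * decay β Γ k := by
        refine Finset.sum_le_sum fun k _ => ?_
        rw [hsplit _ (decay_nonneg hΓ k)]
        exact mul_le_mul_of_nonneg_right (Real.rpow_le_rpow (decay_nonneg hΓ k)
          (decay_le_weightSum hβ hΓ k) (by linarith)) (decay_nonneg hΓ k)
    _ ≤ _ := by
        rw [← Finset.mul_sum]
        exact mul_le_mul_of_nonneg_left (sum_decay_le hβ hΓ F) (Real.rpow_nonneg hV _)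

section Korobov

variable {α lam : ℝ} {γ : Finset (Fin d) → ℝ} {f : (Fin d → ℝ) → ℂ}

theorem norm_fourierCoeffCube_eq (hlam : 0 < lam) (hγ : ∀ u, 0 < γ u) {k : Fin d → ℤ}
    (hk : k ≠ 0) : ‖fourierCoeffCube f k‖ =
      decay (α / lam) (fun u => γ u ^ (1 / lam)) k ^ lam *
        (korobovR α γ k * ‖fourierCoeffCube f k‖) := by
  rw [← mul_assoc, decay_rpow_mul_korobovR hlam hγ hk, one_mul]

theorem sum_sq_le_korobovNorm_sq (hf : MemKorobov α γ f) (F : Finset (Fin d → ℤ)) :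
    ∑ k ∈ F, (korobovR α γ k * ‖fourierCoeffCube f k‖) ^ 2 ≤ korobovNorm α γ f ^ 2 := by
  rw [korobovNorm, Real.sq_sqrt (tsum_nonneg fun k => by positivity)]
  simp_rw [mul_pow]
  exact hf.summable_norm.sum_le_tsum _ fun k _ => by positivity

/-- Worst-case bound, for the event that most draws are bad: Cauchy–Schwarz with `c = 1`, summing
`W^(2λ)` over all frequencies. -/
theorem latticeRule_error_le (hlam : 1 / 2 < lam) (hα : lam < α) (hγ : ∀ u, 0 < γ u)
    (hf : MemKorobov α γ f) {p : ℕ} (hp : 0 < p) (z : Fin d → ℕ) :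
    ‖cubeIntegral f - latticeRule p z f‖ ≤
      weightSum d (α / lam) (fun u => γ u ^ (1 / lam)) ^ lam * korobovNorm α γ f := by
  classical
  have hlam0 : 0 < lam := by linarith
  have hβ : 1 < α / lam := (one_lt_div hlam0).2 hα
  have hΓ : ∀ u, 0 < γ u ^ (1 / lam) := fun u => Real.rpow_pos_of_pos (hγ u) _
  set W := decay (α / lam) fun u => γ u ^ (1 / lam) with hW
  set V := weightSum d (α / lam) fun u => γ u ^ (1 / lam) with hV
  have hV0 : 0 ≤ V := (decay_nonneg hΓ 0).trans (decay_le_weightSum hβ hΓ 0)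
  rw [norm_sub_rev]
  refine norm_le_of_hasSum (hasSum_latticeRule_sub hf hp z)
    (b := fun k => korobovR α γ k * ‖fourierCoeffCube f k‖) (v := fun k => W k ^ lam)
    (c := fun _ => 1) (U := korobovNorm α γ f ^ 2) (Y := V ^ (2 * lam)) (fun _ => one_pos)
    (fun k hk => (norm_fourierCoeffCube_eq hlam0 hγ hk.1).le) (fun F => ?_) (fun F => ?_)
    (mul_nonneg (Real.rpow_nonneg hV0 _) (Real.sqrt_nonneg _)) ?_
  · simpa using sum_sq_le_korobovNorm_sq hf _
  · refine le_trans (le_of_eq (Finset.sum_congr rfl fun k _ => ?_))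
      (sum_decay_rpow_le hβ hΓ (by linarith : 1 < 2 * lam) _)
    rw [one_mul, ← Real.rpow_mul_natCast (decay_nonneg hΓ k), mul_comm lam]
    norm_num
  · rw [mul_pow, ← Real.rpow_mul_natCast hV0, mul_comm (korobovNorm α γ f ^ 2), mul_comm lam]
    norm_num

/-- The contribution of a frequency to the squared Korobov norm, discounted by the number of primes
in `primeRange n` dividing it. -/
def energy (α : ℝ) (γ : Finset (Fin d) → ℝ) (f : (Fin d → ℝ) → ℂ) (n : ℕ) (k : Fin d → ℤ) : ℝ :=
  if k = 0 then 0 else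
    (korobovR α γ k * ‖fourierCoeffCube f k‖) ^ 2 / (max 1 (numDvd n k) : ℕ)

open Classical in
/-- The total discounted energy of the dual lattice. -/
def dualEnergy (α : ℝ) (γ : Finset (Fin d) → ℝ) (f : (Fin d → ℝ) → ℂ) (n : ℕ) (ω : Draw d) : ℝ :=
  ∑' k, if InDual ω k then energy α γ f n k else 0

open Classical in
/-- The total decay weight of the dual lattice. -/
def dualDecay (β : ℝ) (Γ : Finset (Fin d) → ℝ) (ω : Draw d) : ℝ :=
  ∑' k, if InDual ω k then decay β Γ k else 0

theorem energy_nonneg (n : ℕ) (k : Fin d → ℤ) : 0 ≤ energy α γ f n k := by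
  unfold energy
  split_ifs <;> positivity

theorem energy_mul_le (n : ℕ) (k : Fin d → ℤ) {t : ℝ} (ht : t ≤ (max 1 (numDvd n k) : ℕ)) :
    energy α γ f n k * t ≤ (korobovR α γ k * ‖fourierCoeffCube f k‖) ^ 2 := by
  have hc : (0 : ℝ) < (max 1 (numDvd n k) : ℕ) :=
    Nat.cast_pos.2 (lt_of_lt_of_le one_pos (le_max_left _ _))
  unfold energy
  split_ifs
  · rw [zero_mul]; positivity
  · rw [div_mul_eq_mul_div, div_le_iff₀ hc]
    exact mul_le_mul_of_nonneg_left ht (sq_nonneg _)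

theorem energy_le (n : ℕ) (k : Fin d → ℤ) :
    energy α γ f n k ≤ (korobovR α γ k * ‖fourierCoeffCube f k‖) ^ 2 := by
  have := energy_mul_le (α := α) (γ := γ) (f := f) n k (t := 1)
    (Nat.one_le_cast.2 (le_max_left _ _))
  rwa [mul_one] at this

theorem summable_energy (hf : MemKorobov α γ f) (n : ℕ) : Summable (energy α γ f n) :=
  summable_of_sum_le (fun k => energy_nonneg n k) (c := korobovNorm α γ f ^ 2)
    fun F => (Finset.sum_le_sum fun k _ => energy_le n k).trans (sum_sq_le_korobovNorm_sq hf F)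

/-- The discount `1 / max 1 numDvd` cancels the factor `numDvd` in `drawExp_inDual_le`, so no
divisor count survives. -/
theorem drawExp_dualEnergy_le {n : ℕ} (hn : 2 ≤ n) (hf : MemKorobov α γ f) :
    drawExp n d (dualEnergy α γ f n) ≤
      (2 / n + 1 / (primeRange n).card) * korobovNorm α γ f ^ 2 := by
  classical
  obtain ⟨h1, h2⟩ := drawExp_tsum n (fun k => energy_nonneg (α := α) (γ := γ) (f := f) n k)
    (summable_energy hf n)
  refine (le_of_eq h2).trans (h1.tsum_le_of_sum_le fun F => ?_)
  refine le_trans ?_ (mul_le_mul_of_nonneg_left (sum_sq_le_korobovNorm_sq hf F) (by positivity))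
  rw [Finset.mul_sum]
  refine Finset.sum_le_sum fun k _ => ?_
  refine (mul_le_mul_of_nonneg_left (drawExp_inDual_le hn k) (energy_nonneg n k)).trans ?_
  have e1 := energy_le (α := α) (γ := γ) (f := f) n k
  have e2 := energy_mul_le (α := α) (γ := γ) (f := f) n k (t := numDvd n k)
    (Nat.cast_le.2 (le_max_right _ _))
  have e3 : (0 : ℝ) ≤ 2 / n := by positivity
  have e4 : (0 : ℝ) ≤ 1 / (primeRange n).card := by positivity
  calc _ = 2 / n * energy α γ f n k +
        1 / (primeRange n).card * (energy α γ f n k * numDvd n k) := by ring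
    _ ≤ _ := by
      rw [add_mul]
      exact add_le_add (mul_le_mul_of_nonneg_left e1 e3) (mul_le_mul_of_nonneg_left e2 e4)

/-- The error of a lattice rule whose dual lattice has small energy and small total decay. -/
theorem latticeRule_error_le_of_good (hlam : 1 / 2 < lam) (hα : lam < α) (hγ : ∀ u, 0 < γ u)
    (hf : MemKorobov α γ f) {n : ℕ} (hn : 2 ≤ n) {p : ℕ} (hp : 0 < p) (z : Fin d → ℕ) {U r : ℝ}
    (hU : dualEnergy α γ f n ⟨p, z⟩ ≤ U)
    (hS : dualDecay (α / lam) (fun u => γ u ^ (1 / lam)) ⟨p, z⟩ ≤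
      64 * weightSum d (α / lam) (fun u => γ u ^ (1 / lam)) / n)
    (hr : 0 ≤ r)
    (hUr : U * ((1 + 1 / ((2 * lam - 1) * Real.log 2)) *
      (64 * weightSum d (α / lam) (fun u => γ u ^ (1 / lam)) / n) ^ (2 * lam)) ≤ r ^ 2) :
    ‖cubeIntegral f - latticeRule p z f‖ ≤ r := by
  classical
  have hlam0 : 0 < lam := by linarith
  have hβ : 1 < α / lam := (one_lt_div hlam0).2 hα
  have hΓ : ∀ u, 0 < γ u ^ (1 / lam) := fun u => Real.rpow_pos_of_pos (hγ u) _
  have hlog : 0 < Real.log 2 := Real.log_pos (by norm_num)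
  set W := decay (α / lam) fun u => γ u ^ (1 / lam) with hW
  set V := weightSum d (α / lam) fun u => γ u ^ (1 / lam) with hV
  set s := 64 * V / n with hs
  have hη : 0 < 2 * lam - 1 := by linarith
  have hV0 : 0 ≤ V := (decay_nonneg hΓ 0).trans (decay_le_weightSum hβ hΓ 0)
  have hs0 : 0 ≤ s := by positivity
  have hsumE : Summable fun k => if InDual ⟨p, z⟩ k then energy α γ f n k else 0 :=
    (summable_energy hf n).of_nonneg_of_le
      (fun k => by split_ifs; exacts [energy_nonneg n k, le_rfl])
      (fun k => by split_ifs; exacts [le_rfl, energy_nonneg n k])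
  have hsumD : Summable fun k => if InDual ⟨p, z⟩ k then W k else 0 :=
    (summable_decay hβ hΓ).of_nonneg_of_le
      (fun k => by split_ifs; exacts [decay_nonneg hΓ k, le_rfl])
      (fun k => by split_ifs; exacts [le_rfl, decay_nonneg hΓ k])
  have hDF : ∀ F : Finset (Fin d → ℤ),
      ∑ k ∈ F.filter (fun k => k ≠ 0 ∧ InDual ⟨p, z⟩ k), W k ≤ s := fun F => by
    refine le_trans ?_ hS
    refine le_trans (le_of_eq ?_) (hsumD.sum_le_tsum
      (F.filter fun k => k ≠ 0 ∧ InDual ⟨p, z⟩ k) fun k _ => ?_)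
    · exact Finset.sum_congr rfl fun k hk => (if_pos (Finset.mem_filter.1 hk).2.2).symm
    · split_ifs; exacts [decay_nonneg hΓ k, le_rfl]
  rw [norm_sub_rev]
  refine norm_le_of_hasSum (hasSum_latticeRule_sub hf hp z)
    (b := fun k => korobovR α γ k * ‖fourierCoeffCube f k‖) (v := fun k => W k ^ lam)
    (c := fun k => ((max 1 (numDvd n k) : ℕ) : ℝ)) (U := U)
    (Y := (1 + 1 / ((2 * lam - 1) * Real.log 2)) * s ^ (2 * lam))
    (fun k => Nat.cast_pos.2 (lt_of_lt_of_le one_pos (le_max_left _ _)))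
    (fun k hk => (norm_fourierCoeffCube_eq hlam0 hγ hk.1).le) (fun F => ?_) (fun F => ?_) hr hUr
  · refine le_trans ?_ hU
    refine le_trans (le_of_eq ?_) (hsumE.sum_le_tsum
      (F.filter fun k => k ≠ 0 ∧ InDual ⟨p, z⟩ k) fun k _ => ?_)
    · refine Finset.sum_congr rfl fun k hk => ?_
      rw [if_pos (Finset.mem_filter.1 hk).2.2, energy, if_neg (Finset.mem_filter.1 hk).2.1]
    · split_ifs; exacts [energy_nonneg n k, le_rfl]
  -- Each dual `k ≠ 0` satisfies `W k ≤ s`, being one term of the dual decay. So `numDvd_le_rpow`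
  -- applies with exponent `2λ - 1`, and exactly one power of `W k` is left to sum.
  · calc _ ≤ ∑ k ∈ F.filter (fun k => k ≠ 0 ∧ InDual ⟨p, z⟩ k),
          (1 + 1 / ((2 * lam - 1) * Real.log 2)) * s ^ (2 * lam - 1) * W k := by
          refine Finset.sum_le_sum fun k hk => ?_
          have hk' := (Finset.mem_filter.1 hk).2
          have hW0 : 0 < W k := decay_pos hΓ hk'.1
          have hWs : W k ≤ s := by
            have := hDF {k}
            rwa [Finset.filter_singleton, if_pos hk', Finset.sum_singleton] at this
          have hc := numDvd_le_rpow hn hβ hΓ hη hk'.1 hWs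
          have h1 : (W k ^ lam) ^ 2 = W k ^ (2 * lam - 1) * W k := by
            rw [← Real.rpow_mul_natCast hW0.le, ← Real.rpow_add_one hW0.ne']
            congr 1
            push_cast
            ring
          rw [Real.div_rpow hs0 hW0.le] at hc
          have hWp := Real.rpow_pos_of_pos hW0 (2 * lam - 1)
          rw [h1]
          refine (mul_le_mul_of_nonneg_right hc (by positivity)).trans (le_of_eq ?_)
          generalize 1 + 1 / ((2 * lam - 1) * Real.log 2) = A
          field_simp
    _ ≤ (1 + 1 / ((2 * lam - 1) * Real.log 2)) * s ^ (2 * lam - 1) * s := by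
          rw [← Finset.mul_sum]
          exact mul_le_mul_of_nonneg_left (hDF F) (by positivity)
    _ = _ := by
          rw [mul_assoc, ← Real.rpow_add_one' hs0 (by linarith)]
          congr 2
          ring

end Korobov

theorem half_pow_halfReps_le {h : ℕ → ℝ} {n : ℕ} (hn : 2 ≤ n) {e : ℝ} (he : e ≤ h n) :
    (1 / 2 : ℝ) ^ halfReps h n ≤ (n : ℝ) ^ (-e) := by
  have hn0 : (0 : ℝ) < n := by exact_mod_cast (by omega : 0 < n)
  have hn1 : (1 : ℝ) ≤ n := by exact_mod_cast (by omega : 1 ≤ n)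
  have h2 : (n : ℝ) = 2 ^ Real.logb 2 n := (Real.rpow_logb two_pos (by norm_num) hn0).symm
  calc (1 / 2 : ℝ) ^ halfReps h n = 2 ^ (-(halfReps h n : ℝ)) := by
        rw [Real.rpow_neg two_pos.le, Real.rpow_natCast, one_div, inv_pow]
    _ ≤ 2 ^ (-(h n * Real.logb 2 n)) :=
        Real.rpow_le_rpow_of_exponent_le one_le_two (neg_le_neg (Nat.le_ceil _))
    _ = (n : ℝ) ^ (-h n) := by
        conv_rhs => rw [h2, ← Real.rpow_mul two_pos.le]
        congr 1
        ring
    _ ≤ _ := Real.rpow_le_rpow_of_exponent_le hn1 (neg_le_neg he)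

end

end MedianLattice
end

open MedianLattice

/-! ### Assembly of the main theorem. -/

theorem theorem3 (lam δ : ℝ) (hlam : 1 / 2 < lam) (hδ : 0 < δ) (hδ' : δ < min (lam - 1 / 2) 1) :
    ∃ C : ℝ, 0 < C ∧
      ∀ (h : ℕ → ℝ), (∀ m, 1 ≤ h m) → Filter.Tendsto h Filter.atTop Filter.atTop →
      ∀ (d : ℕ), 1 ≤ d →
      ∀ (α : ℝ), lam < α →
      ∀ (γ : Finset (Fin d) → ℝ), (∀ u, 0 < γ u ∧ γ u ≤ 1) →
      ∀ (f : (Fin d → ℝ) → ℂ), MemKorobov α γ f →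
      ∀ (n : ℕ), 2 ≤ n → 64 * weightSum d (α / lam) (fun u => γ u ^ (1 / lam)) ≤ (n : ℝ) →
        lam + 1 / 2 ≤ h n →
        expectation n d (2 * halfReps h n + 1) (fun ω => ‖cubeIntegral f - medianRule ω f‖)
          ≤ C * weightSum d (α / lam) (fun u => γ u ^ (1 / lam)) ^ lam
              * (n : ℝ) ^ (-lam - 1 / 2 + δ) * korobovNorm α γ f := by
  classical
  -- The loss `n^(2δ)` in the energy becomes `n^δ` after the square root.
  obtain ⟨C₁, hC₁, hprimes⟩ := exists_rpow_le_card_primeRange (θ := 1 - 2 * δ) (by linarith)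
  have hlog : 0 < Real.log 2 := Real.log_pos (by norm_num)
  have hη : 0 < 2 * lam - 1 := by linarith
  set A := 1 + 1 / ((2 * lam - 1) * Real.log 2) with hA
  have hA0 : 0 < A := by positivity
  -- Here 16 is the Markov factor for the energy, `2 + C₁` comes from its mean, `A` from the divisor
  -- count, and `64 = 16 * 4` from Markov for the decay.
  set C₂ := √(16 * (2 + C₁) * A) * 64 ^ lam with hC₂
  have hC₂0 : 0 ≤ C₂ := by positivity
  refine ⟨2 * C₂ + 2, by positivity, ?_⟩
  intro h _ _ d hd α hα γ hγ f hf n hn _ hh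
  have hγ0 : ∀ u, 0 < γ u := fun u => (hγ u).1
  have hlam0 : 0 < lam := by linarith
  have hβ : 1 < α / lam := (one_lt_div hlam0).2 hα
  have hΓ : ∀ u, 0 < γ u ^ (1 / lam) := fun u => Real.rpow_pos_of_pos (hγ0 u) _
  have hn0 : (0 : ℝ) < n := by exact_mod_cast (by omega : 0 < n)
  have hn1 : (1 : ℝ) ≤ n := by exact_mod_cast (by omega : 1 ≤ n)
  have hP := primeRange_nonempty hn
  have hP0 : (0 : ℝ) < (primeRange n).card := by exact_mod_cast hP.card_pos
  have hV0 := weightSum_pos hd hβ hΓ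
  set V := weightSum d (α / lam) fun u => γ u ^ (1 / lam) with hV
  set N := korobovNorm α γ f with hN
  have hN0 : 0 ≤ N := Real.sqrt_nonneg _
  set M := (2 + C₁) * (n : ℝ) ^ (-1 + 2 * δ) * N ^ 2 with hM
  set r := C₂ * V ^ lam * (n : ℝ) ^ (-lam - 1 / 2 + δ) * N with hr
  have hr0 : 0 ≤ r := by positivity
  have hEM : drawExp n d (dualEnergy α γ f n) ≤ M := by
    refine (drawExp_dualEnergy_le hn hf).trans (mul_le_mul_of_nonneg_right ?_ (sq_nonneg _))
    rw [add_mul]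
    refine add_le_add ?_ ?_
    · rw [div_eq_mul_inv, ← Real.rpow_neg_one]
      exact mul_le_mul_of_nonneg_left
        (Real.rpow_le_rpow_of_exponent_le hn1 (by linarith)) two_pos.le
    · rw [show -1 + 2 * δ = -(1 - 2 * δ) by ring, Real.rpow_neg hn0.le, ← div_eq_mul_inv,
        div_le_div_iff₀ hP0 (Real.rpow_pos_of_pos hn0 _), one_mul]
      exact hprimes n hn
  have hUr : 16 * M * (A * (64 * V / n) ^ (2 * lam)) ≤ r ^ 2 := by
    refine le_of_eq ?_
    have e1 : ∀ x : ℝ, 0 ≤ x → (x ^ lam) ^ 2 = x ^ (2 * lam) := fun x hx => by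
      rw [← Real.rpow_mul_natCast hx, mul_comm]; norm_num
    have e2 : ((n : ℝ) ^ (-lam - 1 / 2 + δ)) ^ 2 =
        (n : ℝ) ^ (-1 + 2 * δ) * ((n : ℝ) ^ (2 * lam))⁻¹ := by
      rw [← Real.rpow_mul_natCast hn0.le, ← Real.rpow_neg hn0.le, ← Real.rpow_add hn0]
      congr 1
      push_cast
      ring
    rw [hr, mul_pow, mul_pow, mul_pow, hC₂, mul_pow, Real.sq_sqrt (by positivity), e1 _ hV0.le,
      e1 64 (by norm_num), e2, Real.div_rpow (by positivity) hn0.le,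
      Real.mul_rpow (by norm_num) hV0.le, hM, div_eq_mul_inv]
    ring
  -- A draw is bad if either quantity exceeds 16 times its mean bound; each has probability at most
  -- `1/16`.
  obtain ⟨B, hBiff⟩ : ∃ B : Draw d → Prop, ∀ ω, B ω ↔ 16 * M < dualEnergy α γ f n ω ∨
      16 * (4 * V / n) < dualDecay (α / lam) (fun u => γ u ^ (1 / lam)) ω := ⟨_, fun _ => Iff.rfl⟩
  have hB : drawExp n d (fun ω => if B ω then 1 else 0) ≤ 1 / 8 := by
    have b1 := drawExp_indicator_le (M := M) (g := dualEnergy α γ f n) (fun ω _ => tsum_nonneg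
      fun k => by
        split_ifs
        exacts [energy_nonneg n k, le_rfl]) hEM
    have b2 := drawExp_indicator_le (M := 4 * V / n)
      (g := dualDecay (α / lam) fun u => γ u ^ (1 / lam)) (fun ω _ => tsum_nonneg
        fun k => by
          split_ifs
          exacts [decay_nonneg hΓ k, le_rfl]) (drawExp_tsum_decay_le hn hβ hΓ)
    refine le_trans (drawExp_mono fun ω _ => ?_) ((drawExp_add n d _ _).le.trans
      ((add_le_add b1 b2).trans (by norm_num)))
    by_cases hb : B ω
    · rcases (hBiff ω).1 hb with hb' | hb' <;> rw [if_pos hb, if_pos hb'] <;> split_ifs <;> norm_num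
    · rw [if_neg hb]
      split_ifs <;> norm_num
  have hpos : ∀ ω ∈ draws n d, 0 < ω.1 := fun ω hω =>
    (mem_primeRange.1 (Finset.mem_sigma.1 hω).1).2.pos
  have hmain := expectation_le_of_bad (halfReps h n) hP B hB
    (fun ω => ‖cubeIntegral f - medianRule ω f‖) (2 * r) (2 * (V ^ lam * N)) (by positivity)
    (by positivity)
    (fun ω hω hcard => complexMedian_near_of_card_bad_le _ _ hcard _ _ fun k hk => by
      have hgood : ¬ B (ω k) := fun hb => hk (by simp [hb])
      simp only [hBiff, not_or, not_lt] at hgood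
      exact latticeRule_error_le_of_good hlam hα hγ0 hf hn (hpos _ (hω k)) (ω k).2 hgood.1
        (hgood.2.trans (le_of_eq (by ring))) hr0 hUr)
    (fun ω hω => complexMedian_near_of_card_bad_le _ ∅ (by simp) _ _ fun k _ =>
      latticeRule_error_le hlam hα hγ0 hf (hpos _ (hω k)) (ω k).2)
  refine hmain.trans ?_
  -- The condition `h n ≥ λ + 1/2` makes the failure probability decay at the target rate.
  have hfail : (1 / 2 : ℝ) ^ halfReps h n ≤ (n : ℝ) ^ (-lam - 1 / 2 + δ) :=
    (half_pow_halfReps_le hn hh).trans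
      (Real.rpow_le_rpow_of_exponent_le hn1 (by linarith))
  calc 2 * r + 2 * (V ^ lam * N) * (1 / 2) ^ halfReps h n
      ≤ 2 * r + 2 * (V ^ lam * N) * (n : ℝ) ^ (-lam - 1 / 2 + δ) := by gcongr
    _ = _ := by rw [hr]; ring
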